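/- Let $(X,d)$ be a geodesic metric space, let $G$ be a countable (discrete) group acting on $X$ by isometries, and fix $o\in X$. For $x,y,z\in X$ write $(x,y)_z=\frac12\big(d(x,z)+d(z,y)-d(x,y)\big)$ for the Gromov product based at $z$. For $A\subseteq X$ let $\pi_A(x)=\{a\in A: d(x,a)=d(x,A)\}$; for $K>0$, $A$ is $K$-contracting if $\pi_A(z)\ne\emptyset$ for all $z\in X$ and $\operatorname{diam}(\pi_A(x)\cup\pi_A(y))\le K$ whenever $d(x,y)\le d(x,A)-K$. An element $g\in G$ is contracting if for some $K>0$ the orbit map $n\in\mathbb Z\mapsto g^no$ is a $K$-quasigeodesic (that is, $\frac1K|n-m|-K\le d(g^no,g^mo)\le K|n-m|+K$ for all $n,m \in \mathbb Z$) with $K$-contracting image. Elements $g,h\in G$ are independent if $\{(n,m)\in\mathbb Z^2: d(g^no,h^mo)<M\}$ is bounded for every $M>0$. Let $\mu$ be a probability measure on $G$ that is non-elementary: the semigroup $\{g_1\cdots g_n: n\ge0,\ g_i\in G,\ \mu(g_i)>0\}$ contains two independent contracting elements. Let $(g_i)_{i\in\mathbb Z}$ be distributed according to the product measure $\mu^{\mathbb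 Z}$ on $G^{\mathbb Z}$, and let $w_n=g_1\cdots g_n$ for $n\ge 0$ (with $w_0=\mathrm{id}$). Then there exists $K>0$ such that for every integer $n\ge0$, $$\mathbb P\big(d(o,w_no)\le Kn\big)\le \frac1K e^{-Kn}$$ and $$\mathbb P\Big(\inf_{k,k'\ge n}(w_ko,w_{k'}o)_o\le Kn\Big)\le\frac1K e^{-Kn}.$$ -/

import Mathlib

noncomputable section

namespace ContractingWalk

section Geometry

variable {X : Type*} [MetricSpace X]

/-- A metric space is geodesic if any two points are joined by an isometrically embedded
interval of length equal to their distance. -/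
def IsGeodesicSpace (X : Type*) [MetricSpace X] : Prop :=
  ∀ x y : X, ∃ γ : ℝ → X, γ 0 = x ∧ γ (dist x y) = y ∧
    ∀ s ∈ Set.Icc (0 : ℝ) (dist x y), ∀ t ∈ Set.Icc (0 : ℝ) (dist x y),
      dist (γ s) (γ t) = |s - t|

/-- The Gromov product of `x` and `y` based at `z`. -/
def gromovProduct (z x y : X) : ℝ := (dist x z + dist z y - dist x y) / 2

/-- The (set-valued) closest point projection of `x` to `A`. -/
def proj (A : Set X) (x : X) : Set X := {a ∈ A | dist x a = Metric.infDist x A}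

/-- `K`-contracting subsets. -/
def IsContractingSet (K : ℝ) (A : Set X) : Prop :=
  (∀ z : X, (proj A z).Nonempty) ∧
    ∀ x y : X, dist x y ≤ Metric.infDist x A - K →
      Metric.ediam (proj A x ∪ proj A y) ≤ ENNReal.ofReal K

/-- `K`-quasigeodesics indexed by the integers. -/
def IsQuasigeodesic (K : ℝ) (x : ℤ → X) : Prop :=
  ∀ n m : ℤ, 1 / K * |((n - m : ℤ) : ℝ)| - K ≤ dist (x n) (x m) ∧
    dist (x n) (x m) ≤ K * |((n - m : ℤ) : ℝ)| + K

/-- Bi-infinite `K`-contracting axes: `K`-contracting `K`-quasigeodesics. -/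
def IsContractingAxis (K : ℝ) (x : ℤ → X) : Prop :=
  IsQuasigeodesic K x ∧ IsContractingSet K (Set.range x)

/-- Two bi-infinite paths are independent if `(n, m) ↦ d(x n, y m)` is proper. -/
def IndependentPaths (x y : ℤ → X) : Prop :=
  ∀ M : ℝ, 0 < M → Bornology.IsBounded {p : ℤ × ℤ | dist (x p.1) (y p.2) < M}

variable {G : Type*} [Group G] [MulAction G X]

/-- The orbit path `n ↦ gⁿ o`. -/
def orbitPath (o : X) (g : G) : ℤ → X := fun n => g ^ n • o

/-- `g` is contracting: its orbit path is a `K`-contracting axis for some `K > 0`. -/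
def IsContractingElement (o : X) (g : G) : Prop :=
  ∃ K : ℝ, 0 < K ∧ IsContractingAxis K (orbitPath o g)

/-- `g` and `h` are independent: their orbit paths are. -/
def IndependentElements (o : X) (g h : G) : Prop :=
  IndependentPaths (orbitPath o g) (orbitPath o h)

end Geometry

section Walk

open MeasureTheory

variable {G : Type*} [Group G] [MeasurableSpace G]

/-- The set of atoms of `μ`. -/
def supp (μ : Measure G) : Set G := {g | μ {g} ≠ 0}

/-- `μ` is non-elementary: the semigroup of all products `g₁ ⋯ gₙ` (`n ≥ 0`) of elements of the
support of `μ` contains two independent contracting isometries. -/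
def IsNonElementary {X : Type*} [MetricSpace X] [MulAction G X] (o : X) (μ : Measure G) : Prop :=
  ∃ a ∈ Submonoid.closure (supp μ), ∃ b ∈ Submonoid.closure (supp μ),
    IsContractingElement o a ∧ IsContractingElement o b ∧ IndependentElements o a b

/-- The product measure `μ^ℤ` on the step space `G^ℤ`. -/
def stepMeasure (μ : Measure G) [IsProbabilityMeasure μ] : Measure (ℤ → G) :=
  Measure.infinitePi fun _ => μ

/-- The position `wₙ = g₁ ⋯ gₙ` at time `n ≥ 0` of the walk with step path `(gᵢ)`. -/
def samplePath (g : ℤ → G) (n : ℕ) : G :=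
  ((List.range n).map fun i : ℕ => g ((i : ℤ) + 1)).prod

end Walk

end ContractingWalk

end

set_option linter.unusedSectionVars false

/-! Large powers `α`, `β` of two independent contracting elements play ping-pong. There is a set `𝒢`
such that, for each point `x`, at most one power of `α` moves `x` outside `𝒢`. A geodesic from `𝒢`
to `β 𝒢` passes near `β o`. Write `α` and `β` as words `u` and `v` in the support of `μ`, and cut
time into blocks of length `N * |u| + |v|`. A block spells one of the `N` words `u ^ j v u ^ (N -
j)` with probability `p = N σ`, each word having the same mass `σ`. Given the rest of the path, each
point behind or ahead of the block excludes at most one `j`. So each of these conditions fails with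
probability at most `σ`, a small fraction of `p`.

A block is good if the walk at times `k` and `m` lies ahead of its segment `v`. This involves only
the block and its future, so revealing blocks backwards gives many good ones
(`stepMeasure_few_good_le`). For a fixed set `I` of blocks, a chain of points advances through the
blocks that have `o` and the previous chain point behind them. This involves only the past, so
revealing blocks forwards shows that few of them stall. A union bound over all `I` and all stalled
subsets reconciles the two directions; it is affordable because stalling is rare for large `N`
(`stepMeasure_stall_le`).

When both estimates hold, the chain ends at linear distance from `o`, near the geodesics from `o` to
the walk at times `k` and `m` (`chain_progress`). Comparing two such waypoints along a geodesic to a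
common later position bounds the Gromov products (`IsWaypoint.le_gromovProduct`). No moment
assumption enters. -/

namespace ContractingWalk

/-! ### Projections to contracting sets, and ping-pong. -/

section Geometry

variable {X : Type*} [MetricSpace X]

/-- `γ` restricts to a geodesic from `x` to `y`, parametrized by arc length. -/
def IsGeodesic (γ : ℝ → X) (x y : X) : Prop :=
  γ 0 = x ∧ γ (dist x y) = y ∧
    ∀ s ∈ Set.Icc (0 : ℝ) (dist x y), ∀ t ∈ Set.Icc (0 : ℝ) (dist x y),
      dist (γ s) (γ t) = |s - t|

lemma IsGeodesic.dist_left {γ : ℝ → X} {x y : X} (h : IsGeodesic γ x y) {t : ℝ}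
    (ht : t ∈ Set.Icc 0 (dist x y)) : dist x (γ t) = t := by
  have := h.2.2 0 ⟨le_rfl, dist_nonneg⟩ t ht
  rw [h.1] at this
  rw [this, zero_sub, abs_neg, abs_of_nonneg ht.1]

lemma IsGeodesic.dist_right {γ : ℝ → X} {x y : X} (h : IsGeodesic γ x y) {t : ℝ}
    (ht : t ∈ Set.Icc 0 (dist x y)) : dist (γ t) y = dist x y - t := by
  have := h.2.2 t ht (dist x y) ⟨dist_nonneg, le_rfl⟩
  rw [h.2.1] at this
  rw [this, abs_sub_comm, abs_of_nonneg (by linarith [ht.2])]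

lemma IsGeodesic.restrict {γ : ℝ → X} {x y : X} (h : IsGeodesic γ x y) {t : ℝ}
    (ht : t ∈ Set.Icc 0 (dist x y)) : IsGeodesic γ x (γ t) := by
  have e := h.dist_left ht
  refine ⟨h.1, by rw [e], fun s hs u hu => ?_⟩
  rw [e] at hs hu
  exact h.2.2 s ⟨hs.1, hs.2.trans ht.2⟩ u ⟨hu.1, hu.2.trans ht.2⟩

lemma IsGeodesic.reverse {γ : ℝ → X} {x y : X} (h : IsGeodesic γ x y) :
    IsGeodesic (fun s => γ (dist x y - s)) y x := by
  refine ⟨by simp [h.2.1], by simp [dist_comm y x, h.1], fun s hs u hu => ?_⟩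
  rw [dist_comm y x] at hs hu
  rw [h.2.2 _ ⟨by linarith [hs.2], by linarith [hs.1]⟩ _
    ⟨by linarith [hu.2], by linarith [hu.1]⟩, abs_sub_comm]
  congr 1; ring

lemma IsGeodesic.dist_add_dist_le {γ : ℝ → X} {x y z : X} (h : IsGeodesic γ x y) {t D : ℝ}
    (ht : t ∈ Set.Icc 0 (dist x y)) (hz : dist (γ t) z ≤ D) :
    dist x z + dist z y ≤ dist x y + 2 * D := by
  have h1 := h.dist_left ht
  have h2 := h.dist_right ht
  have h3 := dist_triangle x (γ t) z
  have h4 := dist_triangle z (γ t) y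
  rw [dist_comm z (γ t)] at h4
  linarith

lemma dist_le_of_isContractingSet {K : ℝ} (hK : 0 < K) {A : Set X} (hA : IsContractingSet K A)
    {x y p q : X} (hp : p ∈ proj A x) (hq : q ∈ proj A y)
    (h : dist x y ≤ Metric.infDist x A - K) : dist p q ≤ K := by
  have h1 := (Metric.edist_le_ediam_of_mem (s := proj A x ∪ proj A y)
    (Or.inl hp) (Or.inr hq)).trans (hA.2 x y h)
  rwa [edist_dist, ENNReal.ofReal_le_ofReal_iff hK.le] at h1

/-- Projections along a geodesic staying away from a contracting set move slowly. -/
lemma dist_proj_le_of_steps {K : ℝ} (hK : 0 < K) {A : Set X} (hA : IsContractingSet K A)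
    {γ : ℝ → X} {v : ℝ} (n : ℕ) : ∀ {u : ℝ}, u ≤ v →
    (∀ s ∈ Set.Icc u v, ∀ t ∈ Set.Icc u v, dist (γ s) (γ t) = |s - t|) →
    (∀ t ∈ Set.Icc u v, 3 * K ≤ Metric.infDist (γ t) A) →
    v - u ≤ (n + 1) * (2 * K) → ∀ {p q : X}, p ∈ proj A (γ u) → q ∈ proj A (γ v) →
    dist p q ≤ (n + 1) * K := by
  induction n with
  | zero =>
    intro u huv hγ hfar hlen p q hp hq
    have := dist_le_of_isContractingSet hK hA hp hq (by
      rw [hγ u ⟨le_rfl, huv⟩ v ⟨huv, le_rfl⟩, abs_sub_comm, abs_of_nonneg (by linarith)]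
      have := hfar u ⟨le_rfl, huv⟩
      norm_num at hlen
      linarith)
    simpa using this
  | succ n ih =>
    intro u huv hγ hfar hlen p q hp hq
    push_cast at hlen ⊢
    have hn : (0 : ℝ) ≤ n := n.cast_nonneg
    by_cases hs : v - u ≤ 2 * K
    · have := dist_le_of_isContractingSet hK hA hp hq (by
        rw [hγ u ⟨le_rfl, huv⟩ v ⟨huv, le_rfl⟩, abs_sub_comm, abs_of_nonneg (by linarith)]
        have := hfar u ⟨le_rfl, huv⟩
        linarith)
      nlinarith
    · push Not at hs
      obtain ⟨w, hw⟩ := hA.1 (γ (u + 2 * K))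
      have h1 := dist_le_of_isContractingSet hK hA hp hw (by
        rw [hγ u ⟨le_rfl, huv⟩ _ ⟨by linarith, by linarith⟩, abs_sub_comm,
          abs_of_nonneg (by linarith)]
        have := hfar u ⟨le_rfl, huv⟩
        linarith)
      have hsub : ∀ t ∈ Set.Icc (u + 2 * K) v, t ∈ Set.Icc u v :=
        fun t ht => ⟨by linarith [ht.1], ht.2⟩
      have h2 := ih (u := u + 2 * K) (by linarith)
        (fun s hs t ht => hγ s (hsub s hs) t (hsub t ht)) (fun t ht => hfar t (hsub t ht))
        (by linarith) hw hq
      linarith [dist_triangle p w q]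

/-- Bounded geodesic image: a geodesic far from a contracting set has small projection. -/
lemma dist_proj_le_of_far {K : ℝ} (hK : 0 < K) {A : Set X} (hA : IsContractingSet K A)
    {γ : ℝ → X} {u v : ℝ} (huv : u ≤ v)
    (hγ : ∀ s ∈ Set.Icc u v, ∀ t ∈ Set.Icc u v, dist (γ s) (γ t) = |s - t|)
    (hfar : ∀ t ∈ Set.Icc u v, 3 * K ≤ Metric.infDist (γ t) A)
    {p q : X} (hp : p ∈ proj A (γ u)) (hq : q ∈ proj A (γ v)) : dist p q ≤ 8 * K := by
  have hu := hfar u ⟨le_rfl, huv⟩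
  have hv := hfar v ⟨huv, le_rfl⟩
  have hdist : ∀ s t, u ≤ s → s ≤ t → t ≤ v → dist (γ s) (γ t) = t - s := fun s t h1 h2 h3 => by
    rw [hγ s ⟨h1, h2.trans h3⟩ t ⟨h1.trans h2, h3⟩, abs_sub_comm, abs_of_nonneg (by linarith)]
  have huv' := hdist u v le_rfl huv le_rfl
  set du := Metric.infDist (γ u) A with hdu
  set dv := Metric.infDist (γ v) A with hdv
  by_cases h1 : v - u ≤ du - K
  · linarith [dist_le_of_isContractingSet hK hA hp hq (by rw [huv']; exact h1)]
  push Not at h1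
  by_cases h2 : v - u ≤ dv - K
  · linarith [dist_comm p q, dist_le_of_isContractingSet hK hA hq hp
      (by rw [dist_comm, huv']; exact h2)]
  push Not at h2
  obtain ⟨p', hp'⟩ := hA.1 (γ (u + (du - K)))
  have e1 := dist_le_of_isContractingSet hK hA hp hp'
    (by rw [hdist u _ le_rfl (by linarith) (by linarith)]; linarith)
  by_cases h3 : v - u ≤ du + dv - 2 * K
  · have e2 := dist_le_of_isContractingSet hK hA hq hp'
      (by rw [dist_comm, hdist _ v (by linarith) (by linarith) le_rfl]; linarith)
    linarith [dist_triangle p p' q, dist_comm p' q]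
  push Not at h3
  obtain ⟨q', hq'⟩ := hA.1 (γ (v - (dv - K)))
  have e2 := dist_le_of_isContractingSet hK hA hq hq'
    (by rw [dist_comm, hdist _ v (by linarith) (by linarith) le_rfl]; linarith)
  have hsub : ∀ t ∈ Set.Icc (u + (du - K)) (v - (dv - K)), t ∈ Set.Icc u v :=
    fun t ht => ⟨by linarith [ht.1], by linarith [ht.2]⟩
  -- The two end pieces move the projection by at most `K` each, and the middle piece, of length
  -- `m`, by at most `m / 2 + K`. The detour through `A` gives `m ≤ dist p q + 2 * K`. Hence `dist p
  -- q ≤ 4 * K + dist p q / 2`.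
  set m := v - (dv - K) - (u + (du - K)) with hm
  have hm0 : 0 ≤ m / (2 * K) := div_nonneg (by linarith) (by linarith)
  have e3 := dist_proj_le_of_steps hK hA ⌊m / (2 * K)⌋₊ (by linarith)
    (fun s hs t ht => hγ s (hsub s hs) t (hsub t ht)) (fun t ht => hfar t (hsub t ht))
    (by
      have := (Nat.lt_floor_add_one (m / (2 * K))).le
      rwa [div_le_iff₀ (by linarith)] at this) hp' hq'
  have e4 : (⌊m / (2 * K)⌋₊ : ℝ) * (2 * K) ≤ m := by
    have := Nat.floor_le hm0
    rwa [le_div_iff₀ (by linarith)] at this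
  have e5 := dist_triangle4 p p' q' q
  have e6 := dist_triangle4 (γ u) p q (γ v)
  have e7 : dist (γ u) p = du := hp.2
  have e8 : dist (γ v) q = dv := hq.2
  rw [dist_comm q (γ v)] at e6
  rw [dist_comm q' q] at e5
  nlinarith

/-- If the projections to a contracting set of the endpoints of a geodesic are far apart, then the
geodesic passes close to the second projection. -/
lemma IsGeodesic.exists_dist_proj_le {K : ℝ} (hK : 0 < K) {A : Set X}
    (hA : IsContractingSet K A) {γ : ℝ → X} {x y p q : X} (h : IsGeodesic γ x y)
    (hp : p ∈ proj A x) (hq : q ∈ proj A y) (hpq : 8 * K < dist p q) :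
    ∃ t ∈ Set.Icc 0 (dist x y), dist (γ t) q ≤ 11 * K := by
  set l := dist x y with hl
  have hl0 : 0 ≤ l := dist_nonneg
  set S := {t ∈ Set.Icc 0 l | Metric.infDist (γ t) A ≤ 3 * K} with hS
  have hSne : S.Nonempty := by
    by_contra hne
    rw [Set.not_nonempty_iff_eq_empty, Set.eq_empty_iff_forall_notMem] at hne
    refine hpq.not_ge (dist_proj_le_of_far hK hA (γ := γ) hl0 h.2.2 (fun t ht => ?_)
      (by rwa [h.1]) (by rwa [h.2.1]))
    by_contra hlt
    exact hne t ⟨ht, (not_le.mp hlt).le⟩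
  have hSb : BddAbove S := ⟨l, fun t ht => ht.1.2⟩
  -- The last time within `3 * K` of `A`. From then on the projection moves by at most `8 * K`,
  -- whence `11 * K`.
  set s := sSup S with hs
  have hsl : s ≤ l := csSup_le hSne fun t ht => ht.1.2
  have hs0 : 0 ≤ s := by
    obtain ⟨t, ht⟩ := hSne
    exact ht.1.1.trans (le_csSup hSb ht)
  have hmove : ∀ a ∈ Set.Icc 0 l, ∀ b ∈ Set.Icc 0 l,
      Metric.infDist (γ a) A ≤ Metric.infDist (γ b) A + |a - b| := fun a ha b hb => by
    rw [← h.2.2 a ha b hb]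
    exact Metric.infDist_le_infDist_add_dist
  have hsS : Metric.infDist (γ s) A ≤ 3 * K := by
    refine le_of_forall_pos_le_add fun ε hε => ?_
    obtain ⟨t, ht, hlt⟩ := exists_lt_of_lt_csSup hSne (sub_lt_self s hε)
    have := hmove s ⟨hs0, hsl⟩ t ht.1
    rw [abs_of_nonneg (sub_nonneg.mpr (le_csSup hSb ht))] at this
    linarith [ht.2]
  refine ⟨s, ⟨hs0, hsl⟩, ?_⟩
  rcases eq_or_lt_of_le hsl with he | hsl'
  · rw [he, hl, h.2.1, (hq.2 : dist y q = _), ← h.2.1, ← hl, ← he]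
    linarith
  obtain ⟨w, hw⟩ := hA.1 (γ s)
  have hss : 3 * K ≤ Metric.infDist (γ s) A := by
    by_contra hlt
    obtain ⟨u, hu1, hu2⟩ := exists_between
      (lt_min hsl' (by linarith : s < s + (3 * K - Metric.infDist (γ s) A)))
    have hul : u ∈ Set.Icc 0 l := ⟨hs0.trans hu1.le, (hu2.trans_le (min_le_left _ _)).le⟩
    have h1 := hmove u hul s ⟨hs0, hsl⟩
    rw [abs_of_nonneg (by linarith)] at h1
    have h2 := hu2.trans_le (min_le_right _ _)
    exact hu1.not_ge (le_csSup hSb ⟨hul, by linarith⟩)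
  have hfar : ∀ t ∈ Set.Icc s l, 3 * K ≤ Metric.infDist (γ t) A := by
    intro t ht
    rcases eq_or_lt_of_le ht.1 with h1 | h1
    · rwa [← h1]
    · by_contra hlt
      exact h1.not_ge (le_csSup hSb ⟨⟨hs0.trans ht.1, ht.2⟩, (not_le.mp hlt).le⟩)
  have h1 := dist_proj_le_of_far hK hA hsl
    (fun a ha b hb => h.2.2 a ⟨hs0.trans ha.1, ha.2⟩ b ⟨hs0.trans hb.1, hb.2⟩) hfar hw
    (q := q) (by rwa [h.2.1])
  linarith [dist_triangle (γ s) w q, (hw.2 : dist (γ s) w = _)]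

/-- `x` projects to `A` within `T` of `z`. -/
def ProjNear (A : Set X) (T : ℝ) (z x : X) : Prop := ∀ p ∈ proj A x, dist p z ≤ T

lemma self_mem_proj {A : Set X} {x : X} (hx : x ∈ A) : x ∈ proj A x :=
  ⟨hx, by rw [dist_self, Metric.infDist_zero_of_mem hx]⟩

/-- Geodesics with endpoints in a contracting set stay close to it. -/
lemma IsGeodesic.exists_mem_dist_le {K : ℝ} (hK : 0 < K) {A : Set X}
    (hA : IsContractingSet K A) {γ : ℝ → X} {x y : X} (h : IsGeodesic γ x y)
    (hx : x ∈ A) (hy : y ∈ A) {t : ℝ} (ht : t ∈ Set.Icc 0 (dist x y)) :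
    ∃ c ∈ A, dist (γ t) c ≤ 33 * K := by
  obtain ⟨c, hc⟩ := hA.1 (γ t)
  refine ⟨c, hc.1, ?_⟩
  have e := h.dist_left ht
  -- Both halves of the geodesic come within `11 * K` of `c`, at times `s ≤ t ≤ u`. So `u - s ≤ 22 *
  -- K`, which traps `γ t`.
  have h1 : ∃ s ∈ Set.Icc 0 t, dist (γ s) c ≤ 11 * K := by
    by_cases hxc : 8 * K < dist x c
    · have := (h.restrict ht).exists_dist_proj_le hK hA (self_mem_proj hx) hc hxc
      rwa [e] at this
    · exact ⟨0, ⟨le_rfl, ht.1⟩, by rw [h.1]; linarith⟩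
  have e' := h.dist_right ht
  have ht' : dist x y - t ∈ Set.Icc 0 (dist y x) := by
    rw [dist_comm y x]; exact ⟨by linarith [ht.2], by linarith [ht.1]⟩
  have h2 : ∃ s ∈ Set.Icc t (dist x y), dist (γ s) c ≤ 11 * K := by
    by_cases hyc : 8 * K < dist y c
    · have hr := h.reverse.restrict ht'
      simp only [sub_sub_cancel] at hr
      obtain ⟨s, hs, hsc⟩ := hr.exists_dist_proj_le hK hA (self_mem_proj hy) hc hyc
      rw [dist_comm y, e'] at hs
      exact ⟨dist x y - s, ⟨by linarith [hs.2], by linarith [hs.1]⟩, hsc⟩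
    · exact ⟨dist x y, ⟨ht.2, le_rfl⟩, by rw [h.2.1]; linarith⟩
  obtain ⟨s, hs, hsc⟩ := h1
  obtain ⟨u, hu, huc⟩ := h2
  have h3 := h.2.2 s ⟨hs.1, hs.2.trans ht.2⟩ u ⟨ht.1.trans hu.1, hu.2⟩
  rw [abs_sub_comm, abs_of_nonneg (by linarith [hs.2, hu.1])] at h3
  have h4 := h.2.2 t ht s ⟨hs.1, hs.2.trans ht.2⟩
  rw [abs_of_nonneg (by linarith [hs.2])] at h4
  linarith [dist_triangle (γ t) (γ s) c, dist_triangle_right (γ s) (γ u) c, hs.2, hu.1]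

variable {G : Type*} [Group G] [MulAction G X]

lemma orbitPath_zero (o : X) (g : G) : orbitPath o g 0 = o := by simp [orbitPath]

lemma base_mem_range_orbitPath (o : X) (g : G) : o ∈ Set.range (orbitPath o g) :=
  ⟨0, orbitPath_zero o g⟩

lemma IsQuasigeodesic.dist_le {K : ℝ} {x : ℤ → X} (h : IsQuasigeodesic K x) (n : ℤ) :
    dist (x n) (x 0) ≤ K * |(n : ℝ)| + K := by
  simpa using (h n 0).2

lemma IsQuasigeodesic.le_dist {K : ℝ} {x : ℤ → X} (h : IsQuasigeodesic K x) (n : ℤ) :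
    1 / K * |(n : ℝ)| - K ≤ dist (x n) (x 0) := by
  simpa using (h n 0).1

/-- The projection of an axis to an independent axis is bounded. -/
lemma exists_projNear_of_independent (hX : IsGeodesicSpace X) {o : X} {a b : G} {K K' : ℝ}
    (hK : 0 < K) (hK' : 0 < K') (ha : IsContractingAxis K (orbitPath o a))
    (hb : IsContractingAxis K' (orbitPath o b)) (hab : IndependentElements o a b) :
    ∃ T : ℝ, 0 ≤ T ∧ ∀ x ∈ Set.range (orbitPath o b),
      ProjNear (Set.range (orbitPath o a)) T o x := by
  obtain ⟨R, hR⟩ := (hab (11 * K + 33 * K' + 1) (by positivity)).subset_closedBall 0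
  refine ⟨8 * K + (K * |R| + K), by positivity, fun x hx p hp => ?_⟩
  have hR0 : 0 ≤ K * |R| + K := by positivity
  by_cases hfar : 8 * K < dist o p
  · obtain ⟨γ, hγ⟩ := hX o x
    have hγ : IsGeodesic γ o x := hγ
    obtain ⟨t, ht, htp⟩ := hγ.exists_dist_proj_le hK ha.2
      (self_mem_proj (base_mem_range_orbitPath o a)) hp hfar
    obtain ⟨c, ⟨m, rfl⟩, hcm⟩ := hγ.exists_mem_dist_le hK' hb.2
      (base_mem_range_orbitPath o b) hx ht
    obtain ⟨n, rfl⟩ := hp.1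
    have hmem : (n, m) ∈ {p : ℤ × ℤ | dist (orbitPath o a p.1) (orbitPath o b p.2)
        < 11 * K + 33 * K' + 1} := by
      have := dist_triangle_left (orbitPath o a n) (orbitPath o b m) (γ t)
      simp only [Set.mem_ofPred_eq]
      linarith
    have hn := hR hmem
    rw [Metric.mem_closedBall, dist_zero_right, Prod.norm_def] at hn
    have hn' : |(n : ℝ)| ≤ |R| := by
      have := (le_max_left _ _).trans hn
      simp only [Int.norm_eq_abs] at this
      exact this.trans (le_abs_self R)
    have h1 := ha.1.dist_le n
    rw [orbitPath_zero] at h1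
    have h2 := mul_le_mul_of_nonneg_left hn' hK.le
    linarith
  · rw [dist_comm p o]; linarith

/-- A point whose projection to one axis is far from the base point projects near the base point
on an independent axis. -/
lemma exists_projNear_of_far (hX : IsGeodesicSpace X) {o : X} {a b : G} {K K' : ℝ}
    (hK : 0 < K) (hK' : 0 < K') (ha : IsContractingAxis K (orbitPath o a))
    (hb : IsContractingAxis K' (orbitPath o b)) (hab : IndependentElements o a b) :
    ∃ T : ℝ, 0 ≤ T ∧ ∀ x : X, ∀ p ∈ proj (Set.range (orbitPath o a)) x, T < dist p o →
      ProjNear (Set.range (orbitPath o b)) T o x := by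
  obtain ⟨T, hT0, hT⟩ := exists_projNear_of_independent hX hK hK' ha hb hab
  -- The geodesic from `x` to its projection `q` passes within `11 * K + T` of `o`. Since `q` is at
  -- least as close to `x` as `o` is, the remaining piece up to `q` has at most that length.
  refine ⟨2 * (11 * K + T), by positivity, fun x p hp hpT q hq => ?_⟩
  obtain ⟨r, hr⟩ := ha.2.1 q
  have hro := hT q hq.1 r hr
  obtain ⟨γ, hγ⟩ := hX x q
  have hγ : IsGeodesic γ x q := hγ
  obtain ⟨t, ht, htr⟩ := hγ.exists_dist_proj_le hK ha.2 hp hr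
    (by linarith [dist_triangle p r o])
  have h1 : dist x q ≤ dist x o := by
    rw [(hq.2 : dist x q = _)]
    exact Metric.infDist_le_dist_of_mem (base_mem_range_orbitPath o b)
  have h2 := hγ.dist_left ht
  have h3 := hγ.dist_right ht
  have h4 := dist_triangle x (γ t) o
  have h5 := dist_triangle (γ t) r o
  have h6 := dist_triangle_left q o (γ t)
  linarith

/-- Ping-pong data extracted from two independent contracting elements: most powers of `α` move a
given point into the set `𝒢` of points which project near `o` on the axis of `β`, and geodesics
from `𝒢` to `β 𝒢` pass near `β o`. -/
structure IsPingPong (o : X) (α β : G) (𝒢 : Set X) (D : ℝ) : Prop where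
  nonneg : 0 ≤ D
  base_mem : o ∈ 𝒢
  comb : ∀ x : X, ∀ i j : ℤ, i ≠ j → α ^ i • x ∈ 𝒢 ∨ α ^ j • x ∈ 𝒢
  disjoint : ∀ x ∈ 𝒢, β • x ∉ 𝒢
  progress : ∀ x ∈ 𝒢, ∀ y ∈ 𝒢, dist (β • o) (β • y) + 1 ≤ dist x (β • y)
  passes : ∀ x ∈ 𝒢, ∀ y ∈ 𝒢, ∀ γ, IsGeodesic γ x (β • y) →
    ∃ t ∈ Set.Icc 0 (dist x (β • y)), dist (γ t) (β • o) ≤ D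

/-- Nontrivial powers of `α` do not commute with `β`. -/
lemma IsPingPong.not_commute {o : X} {α β : G} {𝒢 : Set X} {D : ℝ}
    (h : IsPingPong o α β 𝒢 D) {i : ℤ} (hi : i ≠ 0) : ¬ Commute (α ^ i) β := by
  -- If `α ^ i` commutes with `β` and `α ^ i • o ∈ 𝒢`, then neither `β • o` nor `α ^ i • β • o = β •
  -- α ^ i • o` is in `𝒢`, against `comb` at the exponents `0` and `i`.
  have key : ∀ i : ℤ, i ≠ 0 → Commute (α ^ i) β → α ^ i • o ∉ 𝒢 := by
    intro i hi hc hmem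
    have h1 := h.disjoint _ hmem
    rw [← mul_smul, ← hc.eq, mul_smul] at h1
    rcases h.comb (β • o) 0 i hi.symm with h2 | h2
    · rw [zpow_zero, one_smul] at h2
      exact h.disjoint o h.base_mem h2
    · exact h1 h2
  intro hc
  have hc' : Commute (α ^ (-i)) β := by rw [zpow_neg]; exact hc.inv_left
  rcases h.comb o i (-i) (by omega) with h2 | h2
  · exact key i hi hc h2
  · exact key (-i) (by omega) hc' h2

variable [IsIsometricSMul G X]

lemma smul_range_orbitPath (o : X) (a : G) (n : ℤ) :
    (fun x => a ^ n • x) '' Set.range (orbitPath o a) = Set.range (orbitPath o a) := by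
  ext x
  constructor
  · rintro ⟨_, ⟨m, rfl⟩, rfl⟩
    exact ⟨n + m, by simp [orbitPath, zpow_add, mul_smul]⟩
  · rintro ⟨m, rfl⟩
    exact ⟨_, ⟨-n + m, rfl⟩, by simp [orbitPath, zpow_add, mul_smul]⟩

lemma zpow_smul_mem_proj {o : X} {a : G} (n : ℤ) {x p : X}
    (hp : p ∈ proj (Set.range (orbitPath o a)) x) :
    a ^ n • p ∈ proj (Set.range (orbitPath o a)) (a ^ n • x) := by
  have h : (fun x => a ^ n • x) '' Set.range (orbitPath o a) = Set.range (orbitPath o a) :=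
    smul_range_orbitPath o a n
  refine ⟨h ▸ ⟨p, hp.1, rfl⟩, ?_⟩
  rw [dist_smul, (hp.2 : dist x p = _), ← Metric.infDist_image (isometry_smul X (a ^ n)), h]

lemma exists_large_power {o : X} {a : G} {K : ℝ} (hK : 0 < K)
    (ha : IsQuasigeodesic K (orbitPath o a)) (R : ℝ) :
    ∃ L : ℕ, ∀ i : ℤ, i ≠ 0 → R < dist ((a ^ L) ^ i • o) o := by
  obtain ⟨L, hL⟩ := exists_nat_gt (K * (|R| + K))
  have hL0 : (0 : ℝ) < L := lt_of_le_of_lt (by positivity) hL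
  refine ⟨L, fun i hi => ?_⟩
  have h := ha.le_dist (L * i)
  rw [orbitPath_zero] at h
  have hi' : (1 : ℝ) ≤ |(i : ℝ)| := by exact_mod_cast Int.one_le_abs hi
  have : |R| + K < 1 / K * |((L * i : ℤ) : ℝ)| := by
    push_cast
    rw [abs_mul, abs_of_pos hL0, one_div, inv_mul_eq_div, lt_div_iff₀ hK]
    nlinarith
  simp only [orbitPath, zpow_mul, zpow_natCast] at h
  linarith [le_abs_self R]

/-- `𝒢` consists of the points projecting near `o` on the axis of `b`. If `α ^ i • x ∉ 𝒢`,
independence forces `α ^ i • x` to project near `o` on the axis of `a`. Two such exponents would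
contradict the large displacement of powers of `α`. -/
theorem exists_isPingPong (hX : IsGeodesicSpace X) {o : X} {a b : G}
    (ha : IsContractingElement o a) (hb : IsContractingElement o b)
    (hab : IndependentElements o a b) :
    ∃ (L M : ℕ) (𝒢 : Set X) (D : ℝ), IsPingPong o (a ^ L) (b ^ M) 𝒢 D := by
  obtain ⟨K, hK, ha⟩ := ha
  obtain ⟨K', hK', hb⟩ := hb
  obtain ⟨T, hT0, hT⟩ := exists_projNear_of_far hX hK hK' ha hb hab
  obtain ⟨L, hL⟩ := exists_large_power hK ha.1 (2 * T)
  set D := 11 * K' + T with hD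
  -- The part `2 * T + 8 * K'` separates the projections enough for geodesics to pass near `b ^ M •
  -- o`. The part `4 * D + 2` yields `dist x (b ^ M • o) ≥ 2 * D + 1`, which pays for the detour `2
  -- * D` and leaves progress `1`.
  obtain ⟨M, hM⟩ := exists_large_power hK' hb.1 (2 * T + 8 * K' + 4 * D + 2)
  have hM : 2 * T + 8 * K' + 4 * D + 2 < dist (b ^ M • o) o := by simpa using hM 1 one_ne_zero
  have hD0 : 0 ≤ D := by positivity
  set B := Set.range (orbitPath o b) with hB
  have hshift : ∀ x ∈ {x | ProjNear B T o x}, ProjNear B T (b ^ M • o) (b ^ M • x) := by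
    intro x hx p hp
    have h1 := zpow_smul_mem_proj (-M : ℤ) hp
    rw [← zpow_natCast b M, ← mul_smul, ← zpow_add, neg_add_cancel, zpow_zero, one_smul] at h1
    have h2 := hx _ h1
    rwa [← dist_smul (b ^ (M : ℤ)), ← mul_smul, ← zpow_add, add_neg_cancel, zpow_zero, one_smul,
      zpow_natCast] at h2
  have hpass : ∀ x ∈ {x | ProjNear B T o x}, ∀ y ∈ {x | ProjNear B T o x}, ∀ γ,
      IsGeodesic γ x (b ^ M • y) →
      ∃ t ∈ Set.Icc 0 (dist x (b ^ M • y)), dist (γ t) (b ^ M • o) ≤ D := by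
    intro x hx y hy γ hγ
    obtain ⟨p, hp⟩ := hb.2.1 x
    obtain ⟨q, hq⟩ := hb.2.1 (b ^ M • y)
    have h1 := hx p hp
    have h2 := hshift y hy q hq
    obtain ⟨t, ht, htq⟩ := hγ.exists_dist_proj_le hK' hb.2 hp hq (by
      have := dist_triangle4 (b ^ M • o) q p o
      rw [dist_comm (b ^ M • o) q, dist_comm q p] at this
      linarith)
    exact ⟨t, ht, by linarith [dist_triangle (γ t) q (b ^ M • o)]⟩
  refine ⟨L, M, {x | ProjNear B T o x}, D, hD0, ?_, ?_, ?_, ?_, hpass⟩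
  · intro p hp
    have := hp.2
    rw [Metric.infDist_zero_of_mem (base_mem_range_orbitPath o b)] at this
    rw [dist_comm p o, this]
    exact hT0
  · intro x i j hij
    by_contra hcon
    push Not at hcon
    obtain ⟨p, hp⟩ := ha.2.1 x
    have hbound : ∀ i : ℤ, (a ^ L) ^ i • x ∉ {x | ProjNear B T o x} →
        dist p ((a ^ L) ^ (-i) • o) ≤ T := by
      intro i hi
      by_contra hlt
      push Not at hlt
      refine hi (hT _ ((a ^ L) ^ i • p) ?_ ?_)
      · rw [← zpow_natCast a L, ← zpow_mul]
        exact zpow_smul_mem_proj _ hp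
      · rwa [← dist_smul ((a ^ L) ^ i), ← mul_smul, ← zpow_add, add_neg_cancel, zpow_zero,
          one_smul] at hlt
    have h1 := hbound i hcon.1
    have h2 := hbound j hcon.2
    have h3 := hL (j - i) (sub_ne_zero.mpr hij.symm)
    have h4 := dist_triangle_left ((a ^ L) ^ (-i) • o) ((a ^ L) ^ (-j) • o) p
    rw [← dist_smul ((a ^ L) ^ j), ← mul_smul, ← mul_smul, ← zpow_add, ← zpow_add,
      add_neg_cancel, zpow_zero, one_smul, ← sub_eq_add_neg] at h4
    linarith
  · intro x hx hx'
    obtain ⟨p, hp⟩ := hb.2.1 (b ^ M • x)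
    have h1 := hshift x hx p hp
    have h2 := hx' p hp
    have := dist_triangle_left (b ^ M • o) o p
    linarith
  · intro x hx y hy
    obtain ⟨γ, hγ⟩ := hX x (b ^ M • y)
    have hγ : IsGeodesic γ x (b ^ M • y) := hγ
    obtain ⟨t, ht, htd⟩ := hpass x hx y hy γ hγ
    have h1 := hγ.dist_add_dist_le ht htd
    obtain ⟨p, hp⟩ := hb.2.1 x
    have h2 := hx p hp
    have h3 : dist x p ≤ dist x (b ^ M • o) := by
      rw [(hp.2 : dist x p = _)]
      exact Metric.infDist_le_dist_of_mem ⟨M, by simp [orbitPath]⟩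
    have h4 := dist_triangle4 (b ^ M • o) x p o
    rw [dist_comm _ x] at h4
    linarith

end Geometry

/-! ### Exponential tail bounds for weighted sums over subsets. -/

section Counting

open Finset

lemma exp_neg_two_le : Real.exp (-2) ≤ 1 / 4 := by
  have h := Real.add_one_le_exp (1 : ℝ)
  rw [Real.exp_neg, one_div]
  apply inv_anti₀ (by norm_num)
  have : Real.exp 2 = Real.exp 1 * Real.exp 1 := by rw [← Real.exp_add]; norm_num
  nlinarith

lemma exp_four_le : Real.exp 4 ≤ 64 := by
  have h := Real.exp_one_lt_d9
  have h0 := Real.exp_pos 1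
  have h1 : Real.exp 4 = (Real.exp 1) ^ 4 := by rw [← Real.exp_nat_mul]; norm_num
  rw [h1]
  calc (Real.exp 1) ^ 4 ≤ 2.8 ^ 4 := by gcongr; linarith
    _ ≤ 64 := by norm_num

/-- Binomial lower tail. -/
lemma sum_powerset_small_le {p : ℝ} (hp0 : 0 ≤ p) (hp1 : p ≤ 1) (n : ℕ) :
    ∑ I ∈ (range n).powerset with (#I : ℝ) ≤ p * n / 16, p ^ #I * (1 - p / 2) ^ (n - #I)
      ≤ Real.exp (-(p * n / 8)) := by
  have hp2 : 0 ≤ 1 - p / 2 := by linarith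
  -- Chernoff tilt by `exp (2 * (p * n / 16 - #I)) ≥ 1`. The weights `p` and `1 - p / 2` add up to
  -- more than `1`, but after tilting their sum is at most `1 - p / 4`.
  calc ∑ I ∈ (range n).powerset with (#I : ℝ) ≤ p * n / 16, p ^ #I * (1 - p / 2) ^ (n - #I)
      ≤ ∑ I ∈ (range n).powerset with (#I : ℝ) ≤ p * n / 16, Real.exp (2 * (p * n / 16)) *
          ((Real.exp (-2) * p) ^ #I * (1 - p / 2) ^ (n - #I)) := by
        refine sum_le_sum fun I hI => ?_
        have h1 : 1 ≤ Real.exp (2 * (p * n / 16)) * Real.exp (-2) ^ #I := by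
          rw [← Real.exp_nat_mul, ← Real.exp_add]
          apply Real.one_le_exp
          linarith [(mem_filter.mp hI).2]
        have h2 : 0 ≤ p ^ #I * (1 - p / 2) ^ (n - #I) := by positivity
        rw [mul_pow]
        nlinarith
    _ ≤ ∑ I ∈ (range n).powerset, Real.exp (2 * (p * n / 16)) *
          ((Real.exp (-2) * p) ^ #I * (1 - p / 2) ^ (n - #I)) :=
        sum_le_sum_of_subset_of_nonneg (filter_subset _ _) fun I _ _ => by positivity
    _ = Real.exp (2 * (p * n / 16)) * (Real.exp (-2) * p + (1 - p / 2)) ^ n := by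
        rw [← mul_sum]
        congr 1
        simpa using sum_pow_mul_eq_add_pow (Real.exp (-2) * p) (1 - p / 2) (range n)
    _ ≤ Real.exp (2 * (p * n / 16)) * Real.exp (-(p / 4)) ^ n := by
        have h1 := Real.add_one_le_exp (-(p / 4))
        have h2 := mul_le_mul_of_nonneg_right exp_neg_two_le hp0
        gcongr
        linarith
    _ = Real.exp (-(p * n / 8)) := by
        rw [← Real.exp_nat_mul, ← Real.exp_add]
        congr 1; ring

/-- The total weight of large sets with at least half of their elements marked is small, when
marks are rare. -/
lemma sum_powerset_marked_le {p θ : ℝ} (hp0 : 0 ≤ p) (hθ0 : 0 ≤ θ) (hθ : θ ≤ 1 / 1024)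
    (n : ℕ) :
    ∑ I ∈ (range n).powerset with p * n / 16 < (#I : ℝ),
      ∑ J ∈ I.powerset with #I ≤ 2 * #J, p ^ (#I - #J) * (p * θ ^ 2) ^ #J
      ≤ Real.exp (-(p * n / 8)) := by
  have hinner : ∀ I : Finset ℕ, ∑ J ∈ I.powerset with #I ≤ 2 * #J,
      p ^ (#I - #J) * (p * θ ^ 2) ^ #J ≤ (2 * p * θ) ^ #I := by
    intro I
    calc ∑ J ∈ I.powerset with #I ≤ 2 * #J, p ^ (#I - #J) * (p * θ ^ 2) ^ #J
        ≤ ∑ J ∈ I.powerset with #I ≤ 2 * #J, p ^ #I * θ ^ #I := by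
          refine sum_le_sum fun J hJ => ?_
          obtain ⟨hJ, hIJ⟩ := mem_filter.mp hJ
          rw [mul_pow, ← mul_assoc, ← pow_add,
            Nat.sub_add_cancel (card_le_card (mem_powerset.mp hJ)), ← pow_mul]
          gcongr ?_ * ?_
          exact pow_le_pow_of_le_one hθ0 (by linarith) hIJ
      _ ≤ ∑ J ∈ I.powerset, p ^ #I * θ ^ #I :=
          sum_le_sum_of_subset_of_nonneg (filter_subset _ _) fun J _ _ => by positivity
      _ = (2 * p * θ) ^ #I := by
          rw [sum_const, card_powerset, nsmul_eq_mul, mul_pow, mul_pow]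
          push_cast; ring
  calc _ ≤ ∑ I ∈ (range n).powerset with p * n / 16 < (#I : ℝ), (2 * p * θ) ^ #I :=
        sum_le_sum fun I _ => hinner I
    -- Tilt by `exp (4 * (#I - p * n / 16)) ≥ 1`. The bound on `θ` keeps `exp 4 * 2 * p * θ` below
    -- `p / 8`, which offsets only half of the gain `p / 4` per block.
    _ ≤ ∑ I ∈ (range n).powerset with p * n / 16 < (#I : ℝ), Real.exp (-(4 * (p * n / 16))) *
          ((Real.exp 4 * (2 * p * θ)) ^ #I * 1 ^ (n - #I)) := by
        refine sum_le_sum fun I hI => ?_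
        have h1 : 1 ≤ Real.exp (-(4 * (p * n / 16))) * Real.exp 4 ^ #I := by
          rw [← Real.exp_nat_mul, ← Real.exp_add]
          apply Real.one_le_exp
          linarith [(mem_filter.mp hI).2]
        have h2 : 0 ≤ (2 * p * θ) ^ #I := by positivity
        rw [mul_pow (Real.exp 4), one_pow]
        nlinarith
    _ ≤ ∑ I ∈ (range n).powerset, Real.exp (-(4 * (p * n / 16))) *
          ((Real.exp 4 * (2 * p * θ)) ^ #I * 1 ^ (n - #I)) :=
        sum_le_sum_of_subset_of_nonneg (filter_subset _ _) fun I _ _ => by positivity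
    _ = Real.exp (-(4 * (p * n / 16))) * (Real.exp 4 * (2 * p * θ) + 1) ^ n := by
        rw [← mul_sum]
        congr 1
        simpa using sum_pow_mul_eq_add_pow (Real.exp 4 * (2 * p * θ)) 1 (range n)
    _ ≤ Real.exp (-(4 * (p * n / 16))) * Real.exp (p / 8) ^ n := by
        have h1 := Real.add_one_le_exp (p / 8)
        have h2 : Real.exp 4 * (2 * p * θ) ≤ 64 * (2 * p * (1 / 1024)) := by
          have := exp_four_le
          gcongr
        gcongr
        linarith
    _ = Real.exp (-(p * n / 8)) := by
        rw [← Real.exp_nat_mul, ← Real.exp_add]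
        congr 1; ring

end Counting

/-! ### Events determined by finitely many increments, and their independence. -/

section Independence

open MeasureTheory Finset

/-- Successive conditional bounds multiply. -/
lemma measureReal_biInter_le_prod {Ω : Type*} [MeasurableSpace Ω] (P : Measure Ω)
    [IsProbabilityMeasure P] (𝒟 : ℕ → Set Ω → Prop) (E : ℕ → Set Ω) (q : ℕ → ℝ) (n : ℕ)
    (h0 : 𝒟 0 Set.univ) (hE : ∀ i < n, ∀ H, 𝒟 i H → 𝒟 (i + 1) (H ∩ E i))
    (hq0 : ∀ i < n, 0 ≤ q i)
    (hq : ∀ i < n, ∀ H, 𝒟 i H → P.real (H ∩ E i) ≤ q i * P.real H) :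
    P.real {ω | ∀ i < n, ω ∈ E i} ≤ ∏ i ∈ range n, q i := by
  suffices h : ∀ k ≤ n, 𝒟 k {ω | ∀ i < k, ω ∈ E i} ∧
      P.real {ω | ∀ i < k, ω ∈ E i} ≤ ∏ i ∈ range k, q i from (h n le_rfl).2
  intro k
  induction k with
  | zero => intro _; simp [h0]
  | succ k ih =>
    intro hk
    have he : {ω | ∀ i < k + 1, ω ∈ E i} = {ω | ∀ i < k, ω ∈ E i} ∩ E k := by
      ext ω
      simp only [Set.mem_ofPred_eq, Set.mem_inter_iff, Nat.lt_succ_iff]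
      exact ⟨fun h => ⟨fun i hi => h i hi.le, h k le_rfl⟩, fun h i hi =>
        (lt_or_eq_of_le hi).elim (h.1 i) fun e => e ▸ h.2⟩
    obtain ⟨h1, h2⟩ := ih (by omega)
    rw [he, prod_range_succ, mul_comm]
    exact ⟨hE k hk _ h1, (hq k hk _ h1).trans (by gcongr; exact hq0 k hk)⟩

lemma prod_ite_mem_of_subset {I S : Finset ℕ} (hI : I ⊆ S) (a b : ℝ) :
    ∏ i ∈ S, (if i ∈ I then a else b) = a ^ #I * b ^ (#S - #I) := by
  rw [prod_ite, prod_const, prod_const]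
  congr 2
  · congr 1; ext i; simpa using fun h => hI h
  · rw [← sdiff_eq_filter, card_sdiff_of_subset hI]

variable {G : Type*}

/-- A set of step paths which depends only on the increments at times `a < t ≤ b`. -/
def DependsOnSteps (a b : ℕ) (H : Set (ℤ → G)) : Prop :=
  ∀ g g' : ℤ → G, (∀ t : ℕ, a ≤ t → t < b → g (t + 1) = g' (t + 1)) → g ∈ H → g' ∈ H

lemma DependsOnSteps.mono {a b a' b' : ℕ} {H : Set (ℤ → G)} (h : DependsOnSteps a b H)
    (ha : a' ≤ a) (hb : b ≤ b') : DependsOnSteps a' b' H :=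
  fun g g' hg => h g g' fun t h1 h2 => hg t (ha.trans h1) (h2.trans_le hb)

lemma DependsOnSteps.inter {a b : ℕ} {H H' : Set (ℤ → G)} (h : DependsOnSteps a b H)
    (h' : DependsOnSteps a b H') : DependsOnSteps a b (H ∩ H') :=
  fun g g' hg hm => ⟨h g g' hg hm.1, h' g g' hg hm.2⟩

lemma DependsOnSteps.compl {a b : ℕ} {H : Set (ℤ → G)} (h : DependsOnSteps a b H) :
    DependsOnSteps a b Hᶜ :=
  fun g g' hg hm hm' => hm (h g' g (fun t h1 h2 => (hg t h1 h2).symm) hm')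

lemma DependsOnSteps.iUnion {ι : Type*} {a b : ℕ} {H : ι → Set (ℤ → G)}
    (h : ∀ j, DependsOnSteps a b (H j)) : DependsOnSteps a b (⋃ j, H j) := by
  intro g g' hg hm
  obtain ⟨j, hj⟩ := Set.mem_iUnion.mp hm
  exact Set.mem_iUnion.mpr ⟨j, h j g g' hg hj⟩

lemma DependsOnSteps.univ (a b : ℕ) : DependsOnSteps a b (Set.univ : Set (ℤ → G)) :=
  fun _ _ _ _ => trivial

/-- The finset of indices of the increments at times `a < t ≤ b`. -/
def stepIndices (a b : ℕ) : Finset ℤ := (Ico a b).image fun t : ℕ => (t : ℤ) + 1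

lemma DependsOnSteps.eq_preimage {a b : ℕ} {H : Set (ℤ → G)} (h : DependsOnSteps a b H) :
    H = (fun (g : ℤ → G) (i : stepIndices a b) => g i) ⁻¹'
      ((fun (g : ℤ → G) (i : stepIndices a b) => g i) '' H) := by
  refine Set.Subset.antisymm (Set.subset_preimage_image _ _) ?_
  rintro g ⟨g', hg', he⟩
  refine h g' g (fun t h1 h2 => ?_) hg'
  exact congrFun he ⟨(t : ℤ) + 1, mem_image.mpr ⟨t, mem_Ico.mpr ⟨h1, h2⟩, rfl⟩⟩

/-- The list of the `n` increments following time `c`. -/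
def stepWord (g : ℤ → G) (c n : ℕ) : List G :=
  (List.range n).map fun t => g (((c + t : ℕ) : ℤ) + 1)

lemma stepWord_add (g : ℤ → G) (c m n : ℕ) :
    stepWord g c (m + n) = stepWord g c m ++ stepWord g (c + m) n := by
  simp [stepWord, List.range_add, add_assoc]

lemma stepWord_congr {g g' : ℤ → G} {c n : ℕ}
    (h : ∀ t : ℕ, c ≤ t → t < c + n → g (t + 1) = g' (t + 1)) :
    stepWord g c n = stepWord g' c n := by
  refine List.map_congr_left fun t ht => h (c + t) (by omega) ?_
  have := List.mem_range.mp ht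
  omega

lemma dependsOnSteps_stepWord (c n : ℕ) (S : Set (List G)) :
    DependsOnSteps c (c + n) {g | stepWord g c n ∈ S} := fun g g' hg hm => by
  rw [Set.mem_ofPred_eq] at hm ⊢
  rwa [← stepWord_congr hg]

variable [Group G]

lemma samplePath_eq_prod (g : ℤ → G) (n : ℕ) : samplePath g n = (stepWord g 0 n).prod := by
  simp [samplePath, stepWord]

lemma samplePath_add (g : ℤ → G) (m n : ℕ) :
    samplePath g (m + n) = samplePath g m * (stepWord g m n).prod := by
  simp [samplePath_eq_prod, stepWord_add]

lemma samplePath_congr {g g' : ℤ → G} {n : ℕ} (h : ∀ t : ℕ, t < n → g (t + 1) = g' (t + 1)) :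
    samplePath g n = samplePath g' n := by
  rw [samplePath_eq_prod, samplePath_eq_prod, stepWord_congr fun t _ ht => h t (by omega)]

variable [Countable G] [MeasurableSpace G] [DiscreteMeasurableSpace G]

/-- The event is pulled back from a finite power of `G`, which is countable, so all its subsets are
measurable. The events built below therefore need no measurability argument of their own. -/
lemma DependsOnSteps.measurableSet {a b : ℕ} {H : Set (ℤ → G)} (h : DependsOnSteps a b H) :
    MeasurableSet H := by
  rw [h.eq_preimage]
  exact (measurable_pi_lambda _ fun i => measurable_pi_apply _) (MeasurableSet.of_discrete)

variable (μ : Measure G) [IsProbabilityMeasure μ]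

instance : IsProbabilityMeasure (stepMeasure μ) := by
  unfold stepMeasure; infer_instance

lemma stepMeasure_inter {a b c d : ℕ} {H H' : Set (ℤ → G)} (h : DependsOnSteps a b H)
    (h' : DependsOnSteps c d H') (hbc : b ≤ c) :
    (stepMeasure μ).real (H ∩ H') = (stepMeasure μ).real H * (stepMeasure μ).real H' := by
  have hdisj : Disjoint (stepIndices a b) (stepIndices c d) := by
    rw [Finset.disjoint_left]
    intro i hi hi'
    simp only [stepIndices, mem_image, mem_Ico] at hi hi'
    omega
  have hind := ProbabilityTheory.iIndepFun.indepFun_finset _ _ hdisj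
    (ProbabilityTheory.iIndepFun_infinitePi (P := fun _ : ℤ => μ) (X := fun _ x => x)
      fun _ => measurable_id) (fun i => measurable_pi_apply i)
  have := hind.measure_inter_preimage_eq_mul
    ((fun (g : ℤ → G) (i : stepIndices a b) => g i) '' H)
    ((fun (g : ℤ → G) (i : stepIndices c d) => g i) '' H')
    MeasurableSet.of_discrete MeasurableSet.of_discrete
  rw [← h.eq_preimage, ← h'.eq_preimage] at this
  rw [measureReal_def, stepMeasure, this, ENNReal.toReal_mul]
  rfl

/-- The probability that prescribed consecutive increments occur. -/
def wordMass (l : List G) : ℝ := (l.map fun x => μ.real {x}).prod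

lemma wordMass_append (l l' : List G) : wordMass μ (l ++ l') = wordMass μ l * wordMass μ l' := by
  simp [wordMass]

lemma wordMass_flatten_replicate (l : List G) (n : ℕ) :
    wordMass μ (List.replicate n l).flatten = wordMass μ l ^ n := by
  induction n with
  | zero => simp [wordMass]
  | succ n ih => rw [List.replicate_succ, List.flatten_cons, wordMass_append, ih, pow_succ']

lemma wordMass_pos {l : List G} (h : ∀ x ∈ l, x ∈ supp μ) : 0 < wordMass μ l := by
  refine List.prod_pos fun y hy => ?_
  obtain ⟨x, hx, rfl⟩ := List.mem_map.mp hy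
  exact measureReal_nonneg.lt_of_ne' (by
    rw [measureReal_ne_zero_iff]; exact h x hx)

lemma stepMeasure_stepWord (c : ℕ) (l : List G) :
    (stepMeasure μ).real {g | stepWord g c l.length = l} = wordMass μ l := by
  induction l generalizing c with
  | nil => simp [stepWord, wordMass]
  | cons x l ih =>
    have h1 : {g : ℤ → G | stepWord g c (x :: l).length = x :: l} =
        {g | stepWord g c 1 ∈ ({[x]} : Set (List G))} ∩
          {g | stepWord g (c + 1) l.length ∈ ({l} : Set (List G))} := by
      ext g
      rw [List.length_cons, add_comm l.length 1]
      simp only [Set.mem_ofPred_eq, stepWord_add, Set.mem_inter_iff, Set.mem_singleton_iff]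
      simp [stepWord]
    rw [h1, stepMeasure_inter μ (dependsOnSteps_stepWord c 1 _)
      (dependsOnSteps_stepWord (c + 1) l.length _) le_rfl]
    simp only [Set.mem_singleton_iff]
    rw [ih (c + 1), wordMass, wordMass, List.map_cons, List.prod_cons]
    congr 1
    have h2 : {g : ℤ → G | stepWord g c 1 = [x]} = (fun g => g ((c : ℤ) + 1)) ⁻¹' {x} := by
      ext g; simp [stepWord]
    rw [h2, measureReal_def, measureReal_def, stepMeasure,
      ← Measure.map_apply (measurable_pi_apply _) (measurableSet_singleton x),
      Measure.infinitePi_map_eval (fun _ : ℤ => μ)]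

/-- Equally likely distinct words `word j`, at most one of which is bad given independent
information, are bad with at most the probability of a single word. -/
lemma measureReal_inter_iUnion_bad_le {Ω ι : Type*} [MeasurableSpace Ω] [Fintype ι]
    (P : Measure Ω) [IsProbabilityMeasure P] {σ : ℝ} (hσ : 0 ≤ σ) {H : Set Ω} {W bad : ι → Set Ω}
    (hind : ∀ j, P.real ((H ∩ bad j) ∩ W j) = P.real (H ∩ bad j) * σ)
    (hmeas : ∀ j, MeasurableSet (H ∩ bad j))
    (hdisj : Pairwise fun i j => Disjoint (bad i) (bad j)) :
    P.real (H ∩ ⋃ j, bad j ∩ W j) ≤ σ * P.real H := by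
  calc P.real (H ∩ ⋃ j, bad j ∩ W j) = P.real (⋃ j, (H ∩ bad j) ∩ W j) := by
        simp only [Set.inter_iUnion, Set.inter_assoc]
    _ ≤ ∑ j, P.real ((H ∩ bad j) ∩ W j) := measureReal_iUnion_fintype_le _
    _ = (∑ j, P.real (H ∩ bad j)) * σ := by simp only [hind, sum_mul]
    -- Disjointness of the bad events is what avoids a factor equal to the number of words.
    _ = P.real (⋃ j, H ∩ bad j) * σ := by
        rw [measureReal_iUnion_fintype _ hmeas]
        exact fun i j hij => (hdisj hij).mono Set.inter_subset_right Set.inter_subset_right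
    _ ≤ P.real H * σ := by
        gcongr
        · exact measure_ne_top _ _
        · exact Set.iUnion_subset fun j => Set.inter_subset_left
    _ = σ * P.real H := mul_comm _ _

end Independence

/-! ### Comb words and translated ping-pong. -/

section Words

variable {G : Type*} [Group G]

/-- The word `u ^ j v u ^ (N - j)`. -/
def combWord (u v : List G) (N : ℕ) (j : Fin N) : List G :=
  (List.replicate j u).flatten ++ v ++ (List.replicate (N - j) u).flatten

/-- The common length of the words `combWord u v N j`. -/
def combLength (u v : List G) (N : ℕ) : ℕ := N * u.length + v.length

lemma length_combWord (u v : List G) (N : ℕ) (j : Fin N) :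
    (combWord u v N j).length = combLength u v N := by
  have h : (N - j) * u.length + j * u.length = N * u.length := by
    rw [← add_mul, Nat.sub_add_cancel j.2.le]
  simp only [combWord, combLength, List.length_append, List.length_flatten, List.map_replicate,
    List.sum_replicate, smul_eq_mul]
  omega

lemma prod_combWord (u v : List G) (N : ℕ) (j : Fin N) :
    (combWord u v N j).prod = u.prod ^ (j : ℕ) * v.prod * u.prod ^ (N - j) := by
  simp [combWord, List.prod_append, List.prod_flatten, List.map_replicate, List.prod_replicate, mul_assoc]

variable {X : Type*} [MetricSpace X] [MulAction G X]

/-- Equality of two of the products would make a nontrivial power of `u.prod` commute with `v.prod`.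
-/
lemma IsPingPong.combWord_injective {o : X} {u v : List G} {𝒢 : Set X} {D : ℝ}
    (h : IsPingPong o u.prod v.prod 𝒢 D) (N : ℕ) : Function.Injective (combWord u v N) := by
  intro i j hij
  by_contra hne
  have he := congrArg List.prod hij
  simp only [prod_combWord] at he
  rw [← zpow_natCast, ← zpow_natCast, ← zpow_natCast, ← zpow_natCast, Nat.cast_sub i.2.le,
    Nat.cast_sub j.2.le] at he
  have hd : ((i : ℕ) : ℤ) - ((j : ℕ) : ℤ) ≠ 0 := by
    rw [sub_ne_zero]; exact fun h => hne (Fin.ext (by exact_mod_cast h))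
  refine h.not_commute hd ?_
  have h2 := congrArg (fun z => u.prod ^ (-((j : ℕ) : ℤ)) * z * u.prod ^ (((i : ℕ) : ℤ) - N)) he
  simp only [mul_assoc, ← zpow_add] at h2
  simp only [← mul_assoc, ← zpow_add, neg_add_cancel, zpow_zero, one_mul] at h2
  rw [show (N : ℤ) - (i : ℕ) + ((i : ℕ) - N) = 0 by ring, zpow_zero, mul_one,
    show (N : ℤ) - (j : ℕ) + ((i : ℕ) - N) = (i : ℕ) - (j : ℕ) by ring,
    neg_add_eq_sub] at h2
  exact h2

/-- Used with exponents `-j` for points behind a block and `N - j` for points ahead of it. -/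
lemma IsPingPong.disjoint_bad {o : X} {α β : G} {𝒢 : Set X} {D : ℝ}
    (h : IsPingPong o α β 𝒢 D) {Ω : Type*} {N : ℕ} (x : Ω → X) (f : Fin N → ℤ)
    (hf : Function.Injective f) :
    Pairwise fun i j => Disjoint {ω | α ^ f i • x ω ∉ 𝒢} {ω | α ^ f j • x ω ∉ 𝒢} := by
  intro i j hij
  rw [Set.disjoint_left]
  intro ω hi hj
  exact (h.comb (x ω) (f i) (f j) fun e => hij (hf e)).elim hi hj

variable [IsIsometricSMul G X]

lemma isGeodesic_smul {γ : ℝ → X} {x y : X} (h : IsGeodesic γ x y) (f : G) :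
    IsGeodesic (fun t => f • γ t) (f • x) (f • y) := by
  simpa only [IsGeodesic, dist_smul, smul_left_cancel_iff] using h

lemma IsPingPong.progress_smul {o : X} {α β : G} {𝒢 : Set X} {D : ℝ}
    (h : IsPingPong o α β 𝒢 D) {f : G} {e y z : X} (he : f⁻¹ • e ∈ 𝒢) (hy : y ∈ 𝒢)
    (hz : z = (f * β) • y) : dist ((f * β) • o) z + 1 ≤ dist e z := by
  have := h.progress _ he _ hy
  rwa [← dist_smul f, ← dist_smul f (f⁻¹ • e), smul_inv_smul, ← mul_smul, ← mul_smul, ← hz] at this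

lemma IsPingPong.passes_smul {o : X} {α β : G} {𝒢 : Set X} {D : ℝ}
    (h : IsPingPong o α β 𝒢 D) {f : G} {e y z : X} (he : f⁻¹ • e ∈ 𝒢) (hy : y ∈ 𝒢)
    (hz : z = (f * β) • y) {γ : ℝ → X} (hγ : IsGeodesic γ e z) :
    ∃ t ∈ Set.Icc 0 (dist e z), dist (γ t) ((f * β) • o) ≤ D := by
  have e1 : f⁻¹ • z = β • y := by rw [hz, mul_smul, inv_smul_smul]
  have h1 := isGeodesic_smul hγ f⁻¹
  rw [e1] at h1
  obtain ⟨t, ht, htd⟩ := h.passes _ he _ hy _ h1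
  rw [← e1, dist_smul] at ht
  refine ⟨t, ht, ?_⟩
  rwa [← dist_smul f⁻¹, mul_smul, inv_smul_smul]

end Words

/-! ### The chain of waypoints. -/

section Chain

open Finset

variable {G : Type*} [Group G] {X : Type*} [MetricSpace X] [MulAction G X]

/-- The block `l`, read from the position `w`, is a comb word whose middle segment starts in the
direction opposite to both `e` and `o`. -/
def Advances (u v : List G) (N : ℕ) (𝒢 : Set X) (o : X) (w : G) (l : List G) (e : X) : Prop :=
  ∃ j : Fin N, l = combWord u v N j ∧ (w * u.prod ^ (j : ℕ))⁻¹ • e ∈ 𝒢 ∧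
    (w * u.prod ^ (j : ℕ))⁻¹ • o ∈ 𝒢

open Classical in
/-- Move to the endpoint of the middle segment of an advancing block. -/
noncomputable def advance (u v : List G) (N : ℕ) (𝒢 : Set X) (o : X) (w : G) (l : List G) (e : X) : X :=
  if h : Advances u v N 𝒢 o w l e then (w * u.prod ^ (h.choose : ℕ) * v.prod) • o else e

lemma advance_of_not {u v : List G} {N : ℕ} {𝒢 : Set X} {o : X} {w : G} {l : List G} {e : X}
    (h : ¬ Advances u v N 𝒢 o w l e) : advance u v N 𝒢 o w l e = e := dif_neg h

lemma Advances.advance_eq {u v : List G} {N : ℕ} {𝒢 : Set X} {o : X} {w : G} {l : List G} {e : X}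
    (h : Advances u v N 𝒢 o w l e) (hinj : Function.Injective (combWord u v N)) {j : Fin N}
    (hj : l = combWord u v N j) :
    (w * u.prod ^ (j : ℕ))⁻¹ • e ∈ 𝒢 ∧ (w * u.prod ^ (j : ℕ))⁻¹ • o ∈ 𝒢 ∧
      advance u v N 𝒢 o w l e = (w * u.prod ^ (j : ℕ) * v.prod) • o := by
  obtain rfl : Exists.choose h = j := hinj (h.choose_spec.1.symm.trans hj)
  exact ⟨h.choose_spec.2.1, h.choose_spec.2.2, dif_pos h⟩

open Classical in
/-- The chain of endpoints obtained by advancing along the blocks in `I`. -/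
noncomputable def chain (u v : List G) (N : ℕ) (𝒢 : Set X) (o : X) (I : Finset ℕ) (g : ℤ → G) : ℕ → X
  | 0 => o
  | i + 1 => if i ∈ I then advance u v N 𝒢 o (samplePath g (i * combLength u v N))
      (stepWord g (i * combLength u v N) (combLength u v N)) (chain u v N 𝒢 o I g i)
      else chain u v N 𝒢 o I g i

/-- The chain is adapted to the past, so its position before a block is independent of that block.
-/
lemma chain_congr (u v : List G) (N : ℕ) (𝒢 : Set X) (o : X) (I : Finset ℕ) {g g' : ℤ → G}
    (i : ℕ) (h : ∀ t : ℕ, t < i * combLength u v N → g (t + 1) = g' (t + 1)) :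
    chain u v N 𝒢 o I g i = chain u v N 𝒢 o I g' i := by
  induction i with
  | zero => rfl
  | succ i ih =>
    rw [add_mul, one_mul] at h
    rw [chain, chain, ih fun t ht => h t (by omega), samplePath_congr fun t ht => h t (by omega),
      stepWord_congr fun t _ ht => h t ht]

/-- The block number `i` advances the chain. -/
def ChainAdvances (u v : List G) (N : ℕ) (𝒢 : Set X) (o : X) (I : Finset ℕ) (g : ℤ → G)
    (i : ℕ) : Prop :=
  Advances u v N 𝒢 o (samplePath g (i * combLength u v N))
    (stepWord g (i * combLength u v N) (combLength u v N)) (chain u v N 𝒢 o I g i)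

/-- If the block number `i` is the comb word number `j`, then after it the walk at time `k`
continues in the direction of its middle segment. -/
def PointsTo (u v : List G) (N : ℕ) (𝒢 : Set X) (o : X) (g : ℤ → G) (i : ℕ) (j : Fin N)
    (k : ℕ) : Prop :=
  u.prod ^ (N - j : ℕ) • (stepWord g ((i + 1) * combLength u v N)
    (k - (i + 1) * combLength u v N)).prod • o ∈ 𝒢

/-- The block number `i` is a comb word after which the walk at times `k` and `m` continues in
the direction of the middle segment. -/
def IsGoodBlock (u v : List G) (N : ℕ) (𝒢 : Set X) (o : X) (k m : ℕ) (g : ℤ → G)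
    (i : ℕ) : Prop :=
  ∃ j : Fin N, stepWord g (i * combLength u v N) (combLength u v N) = combWord u v N j ∧
    PointsTo u v N 𝒢 o g i j k ∧ PointsTo u v N 𝒢 o g i j m

/-- `e` lies near the geodesics from `o` to `x` and to `y`. -/
def IsWaypoint (D : ℝ) (o x y e : X) : Prop :=
  dist o e + dist e x ≤ dist o x + 2 * D ∧
    ∀ γ, IsGeodesic γ o y → ∃ t ∈ Set.Icc 0 (dist o y), dist (γ t) e ≤ D

lemma samplePath_eq_of_block {u v : List G} {N : ℕ} {g : ℤ → G} {i k : ℕ} {j : Fin N}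
    (hj : stepWord g (i * combLength u v N) (combLength u v N) = combWord u v N j)
    (hk : (i + 1) * combLength u v N ≤ k) (o : X) :
    samplePath g k • o = (samplePath g (i * combLength u v N) * u.prod ^ (j : ℕ) * v.prod) •
      u.prod ^ (N - j : ℕ) • (stepWord g ((i + 1) * combLength u v N)
        (k - (i + 1) * combLength u v N)).prod • o := by
  obtain ⟨d, rfl⟩ := Nat.exists_eq_add_of_le hk
  rw [samplePath_add, add_mul, one_mul, samplePath_add, hj, prod_combWord, Nat.add_sub_cancel_left]
  simp only [mul_smul]

variable [IsIsometricSMul G X]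

open Classical in
/-- Along a set of good blocks, the chain progresses by a definite amount towards the walk at time
`m`, and consists of waypoints. -/
lemma chain_progress (hX : IsGeodesicSpace X) {o : X} {u v : List G} {𝒢 : Set X} {D : ℝ}
    (h : IsPingPong o u.prod v.prod 𝒢 D) {N n k m : ℕ} (hnk : n * combLength u v N ≤ k)
    (hkm : k ≤ m) {I : Finset ℕ} {g : ℤ → G}
    (hI : ∀ i ∈ I, IsGoodBlock u v N 𝒢 o k m g i) {i : ℕ} (hi : i ≤ n) :
    IsWaypoint D o (samplePath g k • o) (samplePath g m • o) (chain u v N 𝒢 o I g i) ∧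
    dist (chain u v N 𝒢 o I g i) (samplePath g m • o) +
      #{t ∈ range i | t ∈ I ∧ ChainAdvances u v N 𝒢 o I g t} ≤ dist o (samplePath g m • o) := by
  induction i with
  | zero =>
    refine ⟨⟨?_, fun γ hγ => ⟨0, ⟨le_rfl, dist_nonneg⟩, ?_⟩⟩, ?_⟩
    · simp [chain, h.nonneg]
    · simp [chain, hγ.1, h.nonneg]
    · simp [chain]
  | succ i ih =>
    obtain ⟨ih1, ih2⟩ := ih (by omega)
    rw [range_add_one, filter_insert]
    by_cases hiI : i ∈ I
    · by_cases hadv : ChainAdvances u v N 𝒢 o I g i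
      · obtain ⟨j, hj, hjk, hjm⟩ := hI i hiI
        -- The previous chain point behind and time `m` ahead give progress; `o` behind and times
        -- `k`, `m` ahead give the waypoint property.
        obtain ⟨hc2, hc3, hc⟩ := Advances.advance_eq hadv (h.combWord_injective N) hj
        have hle : (i + 1) * combLength u v N ≤ k :=
          (Nat.mul_le_mul_right _ hi).trans hnk
        have hstep : chain u v N 𝒢 o I g (i + 1) =
            (samplePath g (i * combLength u v N) * u.prod ^ (j : ℕ) * v.prod) • o := by
          rw [chain, if_pos hiI, hc]
        have ek := samplePath_eq_of_block hj hle o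
        have em := samplePath_eq_of_block hj (hle.trans hkm) o
        have hprog := h.progress_smul hc2 hjm em
        rw [hstep, if_pos ⟨hiI, hadv⟩, card_insert_of_notMem (by simp)]
        refine ⟨⟨?_, fun γ hγ => h.passes_smul hc3 hjm em hγ⟩, ?_⟩
        · obtain ⟨γ, hγ⟩ := hX o (samplePath g k • o)
          obtain ⟨t, ht, htd⟩ := h.passes_smul hc3 hjk ek hγ
          exact IsGeodesic.dist_add_dist_le hγ ht htd
        · push_cast
          linarith
      · have hstep : chain u v N 𝒢 o I g (i + 1) = chain u v N 𝒢 o I g i := by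
          rw [chain, if_pos hiI, advance_of_not hadv]
        rw [hstep, if_neg fun hh => hadv hh.2]
        exact ⟨ih1, ih2⟩
    · have hstep : chain u v N 𝒢 o I g (i + 1) = chain u v N 𝒢 o I g i := by
        rw [chain, if_neg hiI]
      rw [hstep, if_neg fun hh => hiI hh.1]
      exact ⟨ih1, ih2⟩

end Chain

/-! ### Probabilities of comb blocks. -/

section Estimates

open MeasureTheory Finset

variable {G : Type*} [Group G] [Countable G] [MeasurableSpace G] [DiscreteMeasurableSpace G]
  {X : Type*} [MetricSpace X] [MulAction G X]
  (μ : Measure G) [IsProbabilityMeasure μ] {o : X} {u v : List G} {𝒢 : Set X} {D : ℝ} (N : ℕ)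

/-- The common mass of the words `combWord u v N j`. -/
def combMass (u v : List G) : ℝ := wordMass μ u ^ N * wordMass μ v

lemma wordMass_combWord (j : Fin N) : wordMass μ (combWord u v N j) = combMass μ N u v := by
  rw [combWord, wordMass_append, wordMass_append, wordMass_flatten_replicate,
    wordMass_flatten_replicate, combMass, mul_right_comm, ← pow_add,
    Nat.add_sub_cancel' j.2.le]

/-- The event that the block number `i` is `combWord u v N j`. -/
def blockEvent (u v : List G) (i : ℕ) (j : Fin N) : Set (ℤ → G) :=
  {g | stepWord g (i * combLength u v N) (combLength u v N) ∈ ({combWord u v N j} : Set (List G))}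

variable {N}

lemma dependsOnSteps_blockEvent (i : ℕ) (j : Fin N) :
    DependsOnSteps (i * combLength u v N) ((i + 1) * combLength u v N)
      (blockEvent N u v i j) := by
  rw [add_mul, one_mul]
  exact dependsOnSteps_stepWord _ _ _

lemma stepMeasure_blockEvent (i : ℕ) (j : Fin N) :
    (stepMeasure μ).real (blockEvent N u v i j) = combMass μ N u v := by
  rw [← wordMass_combWord μ N j, ← stepMeasure_stepWord μ (i * combLength u v N),
    length_combWord]
  rfl

/-- Events independent of the block number `i`. -/
def AvoidsBlock (L i : ℕ) (H : Set (ℤ → G)) : Prop :=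
  (∃ a, DependsOnSteps a (i * L) H) ∨ ∃ b, DependsOnSteps ((i + 1) * L) b H

lemma stepMeasure_inter_blockEvent {i : ℕ} {H : Set (ℤ → G)}
    (hH : AvoidsBlock (combLength u v N) i H) (j : Fin N) :
    (stepMeasure μ).real (H ∩ blockEvent N u v i j) =
      (stepMeasure μ).real H * combMass μ N u v := by
  rw [← stepMeasure_blockEvent μ i j]
  rcases hH with ⟨a, hH⟩ | ⟨b, hH⟩
  · exact stepMeasure_inter μ hH (dependsOnSteps_blockEvent i j) le_rfl
  · rw [Set.inter_comm, stepMeasure_inter μ (dependsOnSteps_blockEvent i j) hH le_rfl, mul_comm]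

lemma combMass_nonneg : 0 ≤ combMass μ N u v :=
  mul_nonneg (pow_nonneg (List.prod_nonneg (by simp)) _) (List.prod_nonneg (by simp))

lemma AvoidsBlock.measurableSet {L i : ℕ} {H : Set (ℤ → G)} (hH : AvoidsBlock L i H) :
    MeasurableSet H := by
  rcases hH with ⟨a, hH⟩ | ⟨b, hH⟩ <;> exact hH.measurableSet

lemma stepMeasure_inter_iUnion_blockEvent (h : IsPingPong o u.prod v.prod 𝒢 D) {i : ℕ}
    {H : Set (ℤ → G)} (hH : AvoidsBlock (combLength u v N) i H) :
    (stepMeasure μ).real (H ∩ ⋃ j, blockEvent N u v i j) =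
      N * combMass μ N u v * (stepMeasure μ).real H := by
  rw [Set.inter_iUnion, measureReal_iUnion_fintype]
  · simp only [stepMeasure_inter_blockEvent μ hH, sum_const, card_univ, Fintype.card_fin,
      nsmul_eq_mul]
    ring
  · intro j j' hjj'
    refine Disjoint.mono Set.inter_subset_right Set.inter_subset_right ?_
    rw [Set.disjoint_left]
    intro g hg hg'
    exact hjj' (h.combWord_injective N (Eq.trans (Eq.symm hg) hg'))
  · exact fun j => hH.measurableSet.inter (dependsOnSteps_blockEvent i j).measurableSet

lemma mul_combMass_le_one (h : IsPingPong o u.prod v.prod 𝒢 D) : N * combMass μ N u v ≤ 1 := by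
  have := stepMeasure_inter_iUnion_blockEvent (N := N) μ h (i := 0) (H := Set.univ)
    (Or.inl ⟨0, DependsOnSteps.univ _ _⟩)
  rw [probReal_univ, mul_one] at this
  rw [← this]
  exact measureReal_le_one

end Estimates

/-! ### Stalled blocks, good blocks and waypoints. -/

section Estimates

open MeasureTheory Finset

variable {G : Type*} [Group G] [Countable G] [MeasurableSpace G] [DiscreteMeasurableSpace G]
  {X : Type*} [MetricSpace X] [MulAction G X]
  (μ : Measure G) [IsProbabilityMeasure μ] {o : X} {u v : List G} {𝒢 : Set X} {D : ℝ} {N : ℕ}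

lemma ChainAdvances.congr {I : Finset ℕ} {g g' : ℤ → G} {i : ℕ}
    (h : ∀ t : ℕ, t < (i + 1) * combLength u v N → g (t + 1) = g' (t + 1))
    (hg : ChainAdvances u v N 𝒢 o I g i) : ChainAdvances u v N 𝒢 o I g' i := by
  rw [add_mul, one_mul] at h
  rwa [ChainAdvances, ← chain_congr u v N 𝒢 o I i fun t ht => h t (by omega),
    ← samplePath_congr fun t ht => h t (by omega), ← stepWord_congr fun t _ ht => h t ht]

/-- The event that the block number `i` is a comb word but does not advance the chain. -/
def stallEvent (u v : List G) (N : ℕ) (𝒢 : Set X) (o : X) (I : Finset ℕ) (i : ℕ) :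
    Set (ℤ → G) :=
  (⋃ j, blockEvent N u v i j) ∩ {g | ¬ ChainAdvances u v N 𝒢 o I g i}

lemma dependsOnSteps_stallEvent (I : Finset ℕ) (i : ℕ) :
    DependsOnSteps 0 ((i + 1) * combLength u v N) (stallEvent u v N 𝒢 o I i) := by
  refine DependsOnSteps.inter (DependsOnSteps.iUnion fun j =>
    (dependsOnSteps_blockEvent i j).mono (Nat.zero_le _) le_rfl) fun g g' hg hm hm' => hm ?_
  exact ChainAdvances.congr (fun t ht => (hg t (Nat.zero_le _) ht).symm) hm'

/-- A comb block stalls only if its index is the one excluded by the chain point or the one excluded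
by `o`. Both points are seen from the start of the block and known from the past, and each costs
`σ`. -/
lemma stepMeasure_inter_stallEvent_le (h : IsPingPong o u.prod v.prod 𝒢 D) (I : Finset ℕ) {i : ℕ}
    {H : Set (ℤ → G)} (hH : DependsOnSteps 0 (i * combLength u v N) H) :
    (stepMeasure μ).real (H ∩ stallEvent u v N 𝒢 o I i) ≤
      2 * combMass μ N u v * (stepMeasure μ).real H := by
  have key : ∀ x : (ℤ → G) → X, (∀ g g' : ℤ → G,
      (∀ t : ℕ, t < i * combLength u v N → g (t + 1) = g' (t + 1)) → x g = x g') →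
      (stepMeasure μ).real (H ∩ ⋃ j : Fin N, {g | u.prod ^ (-((j : ℕ) : ℤ)) •
        (samplePath g (i * combLength u v N))⁻¹ • x g ∉ 𝒢} ∩ blockEvent N u v i j) ≤
      combMass μ N u v * (stepMeasure μ).real H := by
    intro x hx
    have hdep : ∀ j : Fin N, AvoidsBlock (combLength u v N) i (H ∩ {g | u.prod ^ (-((j : ℕ) : ℤ)) •
        (samplePath g (i * combLength u v N))⁻¹ • x g ∉ 𝒢}) := by
      refine fun j => Or.inl ⟨0, hH.inter fun g g' hg hm => ?_⟩
      rw [Set.mem_ofPred_eq] at hm ⊢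
      rwa [← hx g g' fun t ht => hg t (Nat.zero_le _) ht,
        ← samplePath_congr fun t ht => hg t (Nat.zero_le _) ht]
    exact measureReal_inter_iUnion_bad_le _ (combMass_nonneg μ)
      (fun j => stepMeasure_inter_blockEvent μ (hdep j) j) (fun j => (hdep j).measurableSet)
      (h.disjoint_bad _ _ fun a b hab => Fin.ext (by simpa using hab))
  have h1 := key (fun g => chain u v N 𝒢 o I g i) fun g g' hg => chain_congr u v N 𝒢 o I i hg
  have h2 := key (fun _ => o) fun _ _ _ => rfl
  refine (measureReal_mono (s₂ := (H ∩ ⋃ j : Fin N, {g | u.prod ^ (-((j : ℕ) : ℤ)) •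
      (samplePath g (i * combLength u v N))⁻¹ • chain u v N 𝒢 o I g i ∉ 𝒢} ∩
        blockEvent N u v i j) ∪
      (H ∩ ⋃ j : Fin N, {g | u.prod ^ (-((j : ℕ) : ℤ)) •
      (samplePath g (i * combLength u v N))⁻¹ • o ∉ 𝒢} ∩ blockEvent N u v i j)) ?_
      (measure_ne_top _ _)).trans ((measureReal_union_le _ _).trans (by linarith))
  rintro g ⟨hgH, hgW, hga⟩
  obtain ⟨j, hj⟩ := Set.mem_iUnion.mp hgW
  by_contra hcon
  simp only [Set.mem_union, Set.mem_inter_iff, hgH, true_and, not_or, Set.mem_iUnion,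
    not_exists, not_and, Set.mem_ofPred_eq] at hcon
  refine hga ⟨j, hj, ?_, ?_⟩
  · have := not_imp_not.mp (hcon.1 j) hj
    rwa [zpow_neg, zpow_natCast, ← mul_smul, ← mul_inv_rev] at this
  · have := not_imp_not.mp (hcon.2 j) hj
    rwa [zpow_neg, zpow_natCast, ← mul_smul, ← mul_inv_rev] at this

open Classical in
/-- With overwhelming probability, for every large set of comb blocks, more than half of them
advance the corresponding chain. -/
lemma stepMeasure_stall_le (h : IsPingPong o u.prod v.prod 𝒢 D) {θ : ℝ} (hθ0 : 0 ≤ θ)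
    (hθ : θ ≤ 1 / 1024) (hN : 2 ≤ N * θ ^ 2) (n : ℕ) :
    (stepMeasure μ).real {g | ∃ I ⊆ range n, N * combMass μ N u v * n / 16 < #I ∧
      (∀ i ∈ I, g ∈ ⋃ j, blockEvent N u v i j) ∧
      #I ≤ 2 * #{i ∈ I | ¬ ChainAdvances u v N 𝒢 o I g i}} ≤
    Real.exp (-(N * combMass μ N u v * n / 8)) := by
  set σ := combMass μ N u v with hσ
  have hσ0 : 0 ≤ σ := combMass_nonneg μ
  set p := N * σ with hp
  have hp0 : 0 ≤ p := by positivity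
  refine le_trans ?_ (sum_powerset_marked_le hp0 hθ0 hθ n)
  -- `I` will be the set of good blocks, which depends on the future. Hence the union over all `I`
  -- and all stalled parts `J`, with blocks revealed forwards for fixed `I` and `J`.
  refine (measureReal_mono (s₂ := ⋃ I ∈ (range n).powerset.filter fun I => p * n / 16 < (#I : ℝ),
    ⋃ J ∈ I.powerset.filter fun J => #I ≤ 2 * #J,
      {g | ∀ i < n, g ∈ if i ∈ I then (if i ∈ J then stallEvent u v N 𝒢 o I i else
        ⋃ j, blockEvent N u v i j) else Set.univ}) ?_ (measure_ne_top _ _)).trans ?_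
  · rintro g ⟨I, hI, hIn, hIW, hIJ⟩
    simp only [Set.mem_iUnion]
    refine ⟨I, mem_filter.mpr ⟨mem_powerset.mpr hI, hIn⟩,
      {i ∈ I | ¬ ChainAdvances u v N 𝒢 o I g i},
      mem_filter.mpr ⟨mem_powerset.mpr (filter_subset _ _), hIJ⟩, fun i _ => ?_⟩
    split_ifs with h1 h2
    · exact ⟨hIW i h1, (mem_filter.mp h2).2⟩
    · exact hIW i h1
    · trivial
  refine (measureReal_biUnion_finset_le _ _).trans (sum_le_sum fun I hI => ?_)
  refine (measureReal_biUnion_finset_le _ _).trans (sum_le_sum fun J hJ => ?_)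
  have hI := mem_powerset.mp (mem_filter.mp hI).1
  have hJ := mem_powerset.mp (mem_filter.mp hJ).1
  refine (measureReal_biInter_le_prod _
    (fun i H => DependsOnSteps 0 (i * combLength u v N) H) _
    (fun i => if i ∈ I then (if i ∈ J then p * θ ^ 2 else p) else 1) n
    (DependsOnSteps.univ _ _) ?_ ?_ ?_).trans (le_of_eq ?_)
  · intro i _ H hH
    refine DependsOnSteps.inter (hH.mono le_rfl (Nat.mul_le_mul_right _ (Nat.le_succ i))) ?_
    split_ifs
    · exact dependsOnSteps_stallEvent I i
    · exact DependsOnSteps.iUnion fun j =>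
        (dependsOnSteps_blockEvent i j).mono (Nat.zero_le _) le_rfl
    · exact DependsOnSteps.univ _ _
  · intro i _
    split_ifs <;> positivity
  · intro i _ H hH
    split_ifs
    · refine (stepMeasure_inter_stallEvent_le μ h I hH).trans ?_
      -- This is where `N` must be large: stalling has conditional share `2 / N ≤ θ ^ 2` among comb
      -- blocks.
      have : 2 * σ ≤ p * θ ^ 2 := by
        rw [hp, mul_right_comm]; gcongr
      gcongr
    · exact (stepMeasure_inter_iUnion_blockEvent μ h (Or.inl ⟨0, hH⟩)).le
    · rw [Set.inter_univ, one_mul]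
  · rw [prod_ite_mem, inter_eq_right.mpr hI, prod_ite_mem_of_subset hJ, mul_comm]

lemma dependsOnSteps_pointsTo {i k : ℕ} (hk : (i + 1) * combLength u v N ≤ k) (j : Fin N) :
    DependsOnSteps ((i + 1) * combLength u v N) k {g | PointsTo u v N 𝒢 o g i j k} := by
  intro g g' hg hm
  rw [Set.mem_ofPred_eq, PointsTo] at hm ⊢
  rwa [← stepWord_congr fun t h1 h2 => hg t h1 (by omega)]

lemma setOf_isGoodBlock (k m i : ℕ) : {g | IsGoodBlock u v N 𝒢 o k m g i} =
    ⋃ j, blockEvent N u v i j ∩ ({g | PointsTo u v N 𝒢 o g i j k} ∩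
      {g | PointsTo u v N 𝒢 o g i j m}) := by
  ext g
  simp [IsGoodBlock, blockEvent]

lemma dependsOnSteps_isGoodBlock {i k m : ℕ} (hk : (i + 1) * combLength u v N ≤ k)
    (hkm : k ≤ m) : DependsOnSteps (i * combLength u v N) m
      {g | IsGoodBlock u v N 𝒢 o k m g i} := by
  have h1 : i * combLength u v N ≤ (i + 1) * combLength u v N :=
    Nat.mul_le_mul_right _ (Nat.le_succ i)
  rw [setOf_isGoodBlock]
  exact DependsOnSteps.iUnion fun j => ((dependsOnSteps_blockEvent i j).mono le_rfl
    (hk.trans hkm)).inter (((dependsOnSteps_pointsTo hk j).mono h1 hkm).inter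
      ((dependsOnSteps_pointsTo (hk.trans hkm) j).mono h1 le_rfl))

lemma stepMeasure_inter_isGoodBlock_le (h : IsPingPong o u.prod v.prod 𝒢 D) {i k m : ℕ}
    {H : Set (ℤ → G)} (hH : DependsOnSteps ((i + 1) * combLength u v N) m H) :
    (stepMeasure μ).real (H ∩ {g | IsGoodBlock u v N 𝒢 o k m g i}) ≤
      N * combMass μ N u v * (stepMeasure μ).real H := by
  rw [← stepMeasure_inter_iUnion_blockEvent μ h (Or.inr ⟨m, hH⟩), setOf_isGoodBlock]
  exact measureReal_mono (Set.inter_subset_inter_right _ (Set.iUnion_mono fun j =>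
    Set.inter_subset_left)) (measure_ne_top _ _)

/-- Either the block is no comb word, which has probability `1 - N σ`, or its index is excluded by
the position at time `k` or at time `m`, each costing `σ`. -/
lemma stepMeasure_inter_not_isGoodBlock_le (h : IsPingPong o u.prod v.prod 𝒢 D) {i k m : ℕ}
    (hk : (i + 1) * combLength u v N ≤ k) (hkm : k ≤ m)
    {H : Set (ℤ → G)} (hH : DependsOnSteps ((i + 1) * combLength u v N) m H) :
    (stepMeasure μ).real (H ∩ {g | IsGoodBlock u v N 𝒢 o k m g i}ᶜ) ≤
      (1 - N * combMass μ N u v + 2 * combMass μ N u v) * (stepMeasure μ).real H := by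
  have key : ∀ l, (i + 1) * combLength u v N ≤ l → l ≤ m → (stepMeasure μ).real
      (H ∩ ⋃ j : Fin N, {g | PointsTo u v N 𝒢 o g i j l}ᶜ ∩ blockEvent N u v i j) ≤
      combMass μ N u v * (stepMeasure μ).real H := by
    intro l hl hlm
    have hdep : ∀ j : Fin N, AvoidsBlock (combLength u v N) i
        (H ∩ {g | PointsTo u v N 𝒢 o g i j l}ᶜ) := fun j =>
      Or.inr ⟨m, hH.inter ((dependsOnSteps_pointsTo hl j).mono le_rfl hlm).compl⟩
    refine measureReal_inter_iUnion_bad_le _ (combMass_nonneg μ)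
      (fun j => stepMeasure_inter_blockEvent μ (hdep j) j) (fun j => (hdep j).measurableSet) ?_
    have := h.disjoint_bad (N := N) (fun g : ℤ → G => (stepWord g ((i + 1) * combLength u v N)
      (l - (i + 1) * combLength u v N)).prod • o) (fun j => ((N - j : ℕ) : ℤ))
      (fun a b hab => Fin.ext (by have := a.2; have := b.2; simp only at hab; omega))
    simp only [zpow_natCast] at this
    exact this
  have h1 := key k hk hkm
  have h2 := key m (hk.trans hkm) le_rfl
  have h3 := stepMeasure_inter_iUnion_blockEvent (N := N) μ h (Or.inr ⟨m, hH⟩)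
  have h4 := measureReal_inter_add_sdiff (μ := stepMeasure μ) (s := H)
    (MeasurableSet.iUnion fun j => (dependsOnSteps_blockEvent (u := u) (v := v) (N := N) i
      j).measurableSet)
  refine (measureReal_mono (s₂ := (H \ ⋃ j, blockEvent N u v i j) ∪
    ((H ∩ ⋃ j : Fin N, {g | PointsTo u v N 𝒢 o g i j k}ᶜ ∩ blockEvent N u v i j) ∪
    (H ∩ ⋃ j : Fin N, {g | PointsTo u v N 𝒢 o g i j m}ᶜ ∩ blockEvent N u v i j))) ?_
    (measure_ne_top _ _)).trans ((measureReal_union_le _ _).trans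
      ((add_le_add_right (measureReal_union_le _ _) _).trans (by linarith)))
  rw [setOf_isGoodBlock]
  rintro g ⟨hgH, hg⟩
  by_contra hcon
  simp only [Set.mem_union, Set.mem_inter_iff, Set.mem_sdiff, hgH, true_and, not_or,
    Set.mem_iUnion, not_exists, not_and, Set.mem_compl_iff] at hcon hg
  obtain ⟨hW, hk', hm'⟩ := hcon
  obtain ⟨j, hj⟩ := not_forall_not.mp hW
  exact hg j hj (not_not.mp fun hn => hk' j hn hj) (not_not.mp fun hn => hm' j hn hj)

open Classical in
/-- With overwhelming probability, there are many good blocks. -/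
lemma stepMeasure_few_good_le (h : IsPingPong o u.prod v.prod 𝒢 D) (hN : 4 ≤ N) {n k m : ℕ}
    (hnk : n * combLength u v N ≤ k) (hkm : k ≤ m) :
    (stepMeasure μ).real {g | (#{i ∈ range n | IsGoodBlock u v N 𝒢 o k m g i} : ℝ) ≤
      N * combMass μ N u v * n / 16} ≤ Real.exp (-(N * combMass μ N u v * n / 8)) := by
  set σ := combMass μ N u v with hσ
  have hσ0 : 0 ≤ σ := combMass_nonneg μ
  set p := N * σ with hp
  have hp0 : 0 ≤ p := by positivity
  have hp1 : p ≤ 1 := mul_combMass_le_one μ h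
  have hpσ : 2 * σ ≤ p / 2 := by
    have : (4 : ℝ) ≤ N := by exact_mod_cast hN
    nlinarith
  refine le_trans ?_ (sum_powerset_small_le hp0 hp1 n)
  -- Goodness depends on the future, so blocks are revealed from the last to the first, whence the
  -- index `n - 1 - i`.
  refine (measureReal_mono (s₂ := ⋃ I ∈ (range n).powerset.filter fun I => (#I : ℝ) ≤ p * n / 16,
      {g | ∀ i < n, g ∈ if n - 1 - i ∈ I then {g | IsGoodBlock u v N 𝒢 o k m g (n - 1 - i)} else
        {g | IsGoodBlock u v N 𝒢 o k m g (n - 1 - i)}ᶜ}) ?_ (measure_ne_top _ _)).trans ?_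
  · intro g hg
    simp only [Set.mem_iUnion]
    refine ⟨_, mem_filter.mpr ⟨mem_powerset.mpr (filter_subset _ _), hg⟩, fun i hi => ?_⟩
    split_ifs with h1
    · exact (mem_filter.mp h1).2
    · exact fun h2 => h1 (mem_filter.mpr ⟨mem_range.mpr (by omega), h2⟩)
  refine (measureReal_biUnion_finset_le _ _).trans (sum_le_sum fun I hI => ?_)
  have hI := mem_powerset.mp (mem_filter.mp hI).1
  have hidx : ∀ i < n, n - 1 - i + 1 = n - i ∧ n - 1 - i = n - (i + 1) := by omega
  have hle : ∀ i < n, (n - 1 - i + 1) * combLength u v N ≤ k := fun i hi =>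
    (Nat.mul_le_mul_right _ (by omega)).trans hnk
  refine (measureReal_biInter_le_prod _
    (fun i H => DependsOnSteps ((n - i) * combLength u v N) m H) _
    (fun i => if n - 1 - i ∈ I then p else 1 - p / 2) n
    (DependsOnSteps.univ _ _) ?_ ?_ ?_).trans (le_of_eq ?_)
  · intro i hi H hH
    have hd := dependsOnSteps_isGoodBlock (𝒢 := 𝒢) (o := o) (hle i hi) hkm
    rw [(hidx i hi).2] at hd ⊢
    refine DependsOnSteps.inter (hH.mono (Nat.mul_le_mul_right _ (by omega)) le_rfl) ?_
    split_ifs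
    · exact hd
    · exact hd.compl
  · intro i _
    split_ifs
    · exact hp0
    · linarith
  · intro i hi H hH
    rw [← (hidx i hi).1] at hH
    split_ifs
    · exact stepMeasure_inter_isGoodBlock_le μ h hH
    · refine (stepMeasure_inter_not_isGoodBlock_le μ h (hle i hi) hkm hH).trans ?_
      gcongr
      linarith
  · rw [prod_range_reflect (fun i => if i ∈ I then p else 1 - p / 2), prod_ite_mem_of_subset hI,
      card_range]

variable [IsIsometricSMul G X]

/-- With overwhelming probability, there is a waypoint at linear distance. -/
theorem exists_waypoint_bound (hX : IsGeodesicSpace X) (h : IsPingPong o u.prod v.prod 𝒢 D)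
    (hu : ∀ x ∈ u, x ∈ supp μ) (hv : ∀ x ∈ v, x ∈ supp μ) :
    ∃ c C : ℝ, 0 < c ∧ 0 < C ∧ ∀ k m : ℕ, k ≤ m →
      (stepMeasure μ).real {g | ¬ ∃ e : X, c * k - C ≤ dist o e ∧
        IsWaypoint D o (samplePath g k • o) (samplePath g m • o) e} ≤
      C * Real.exp (-(c * k)) := by
  classical
  -- `2097152 = 2 ^ 21` and `1024 ^ 2 = 2 ^ 20`.
  obtain ⟨N, hN4, hN2⟩ : ∃ N : ℕ, 4 ≤ N ∧ (2 : ℝ) ≤ N * (1 / 1024) ^ 2 :=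
    ⟨2097152, by norm_num, by norm_num⟩
  have hvlen : 0 < v.length := by
    rw [List.length_pos_iff]
    rintro rfl
    have := h.disjoint o h.base_mem
    rw [List.prod_nil, one_smul] at this
    exact this h.base_mem
  set r := combLength u v N with hr
  have hr0 : 0 < r := by rw [hr, combLength]; omega
  have hr0' : (0 : ℝ) < r := by exact_mod_cast hr0
  set p := N * combMass μ N u v with hp
  have hp0 : 0 < p := by
    have h1 : (0 : ℝ) < N := by exact_mod_cast (by omega : 0 < N)
    have h2 := wordMass_pos μ hu
    have h3 := wordMass_pos μ hv
    rw [hp, combMass]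
    positivity
  have hp1 : p ≤ 1 := mul_combMass_le_one μ h
  -- More than half of more than `p * n / 16` good blocks advance, each by at least `1`, and `n` is
  -- about `k / r`. The factor `2` counts the two exceptional events, and `exp (p / 32)` absorbs the
  -- rounding of `k / r`.
  refine ⟨p / (32 * r), 2 * Real.exp (p / 32), by positivity, by positivity, fun k m hkm => ?_⟩
  set n := k / r with hn
  have hnk : n * r ≤ k := Nat.div_mul_le_self k r
  have hkn : (k : ℝ) ≤ (n + 1) * r := by
    have := (Nat.lt_div_mul_add (a := k) hr0).le
    rw [← hn] at this
    have : (k : ℝ) ≤ n * r + r := by exact_mod_cast this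
    linarith
  have hck : p / (32 * r) * k ≤ p * n / 32 + p / 32 := by
    calc p / (32 * r) * k ≤ p / (32 * r) * ((n + 1) * r) := by gcongr
      _ = p * n / 32 + p / 32 := by field_simp
  have hb1 := stepMeasure_few_good_le μ h hN4 hnk hkm
  have hb2 := stepMeasure_stall_le μ h (by norm_num) le_rfl hN2 n
  refine (measureReal_mono (s₂ := {g | (#{i ∈ range n | IsGoodBlock u v N 𝒢 o k m g i} : ℝ) ≤
      p * n / 16} ∪ {g | ∃ I ⊆ range n, p * n / 16 < #I ∧
      (∀ i ∈ I, g ∈ ⋃ j, blockEvent N u v i j) ∧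
      #I ≤ 2 * #{i ∈ I | ¬ ChainAdvances u v N 𝒢 o I g i}}) ?_ (measure_ne_top _ _)).trans
    ((measureReal_union_le _ _).trans ((add_le_add hb1 hb2).trans ?_))
  · intro g hg
    by_contra hcon
    simp only [Set.mem_union, Set.mem_ofPred_eq, not_or, not_le] at hcon
    obtain ⟨hlarge, hstall⟩ := hcon
    set I := {i ∈ range n | IsGoodBlock u v N 𝒢 o k m g i} with hI
    have hIgood : ∀ i ∈ I, IsGoodBlock u v N 𝒢 o k m g i := fun i hi => (mem_filter.mp hi).2
    have hcount : 2 * #{i ∈ I | ¬ ChainAdvances u v N 𝒢 o I g i} < #I := by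
      by_contra hlt
      refine hstall ⟨I, filter_subset _ _, hlarge, fun i hi => ?_, not_lt.mp hlt⟩
      obtain ⟨j, hj, -⟩ := hIgood i hi
      exact Set.mem_iUnion.mpr ⟨j, hj⟩
    have hsplit := card_filter_add_card_filter_not (s := I)
      (fun i => ChainAdvances u v N 𝒢 o I g i)
    obtain ⟨hway, hprog⟩ := chain_progress hX h hnk hkm hIgood (le_refl n)
    refine hg ⟨_, ?_, hway⟩
    have heq : {t ∈ range n | t ∈ I ∧ ChainAdvances u v N 𝒢 o I g t} =
        {t ∈ I | ChainAdvances u v N 𝒢 o I g t} := by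
      ext t
      simp only [mem_filter, hI]
      tauto
    rw [heq] at hprog
    have htri := dist_triangle o (chain u v N 𝒢 o I g n) (samplePath g m • o)
    have hcount' : (#I : ℝ) < 2 * #{t ∈ I | ChainAdvances u v N 𝒢 o I g t} := by
      exact_mod_cast (by omega : #I < 2 * #{t ∈ I | ChainAdvances u v N 𝒢 o I g t})
    have := Real.add_one_le_exp (p / 32)
    linarith
  · have : Real.exp (-(p * n / 8)) ≤ Real.exp (p / 32) * Real.exp (-(p / (32 * r) * k)) := by
      rw [← Real.exp_add]
      apply Real.exp_le_exp.mpr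
      have : 0 ≤ p * n := by positivity
      linarith
    linarith

end Estimates

/-! ### From waypoints to Gromov products. -/

section Conclusion

open MeasureTheory Finset

variable {X : Type*} [MetricSpace X]

lemma gromovProduct_nonneg (z x y : X) : 0 ≤ gromovProduct z x y := by
  have := dist_triangle x z y
  rw [gromovProduct]
  linarith

lemma gromovProduct_self (z x : X) : gromovProduct z x x = dist z x := by
  rw [gromovProduct, dist_self, dist_comm x z]
  ring

/-- Both waypoints are `D`-close to one geodesic from `o` to `y`, at times `t` and `t'`. Going from
`x` to `x'` through `e` and `e'` bounds the Gromov product below by `min t t' - 4 * D`, and both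
times are at least `A - D`. -/
lemma IsWaypoint.le_gromovProduct (hX : IsGeodesicSpace X) {D A : ℝ} {o x x' y e e' : X}
    (h : IsWaypoint D o x y e) (h' : IsWaypoint D o x' y e') (he : A ≤ dist o e)
    (he' : A ≤ dist o e') : A - 5 * D ≤ gromovProduct o x x' := by
  obtain ⟨γ, hγ⟩ := hX o y
  have hγ : IsGeodesic γ o y := hγ
  obtain ⟨t, ht, hte⟩ := h.2 γ hγ
  obtain ⟨t', ht', hte'⟩ := h'.2 γ hγ
  have h1 := hγ.2.2 t ht t' ht'
  have h2 := hγ.dist_left ht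
  have h3 := hγ.dist_left ht'
  have h4 := dist_triangle o (γ t) e
  have h5 := dist_triangle o (γ t') e'
  have h6 := dist_triangle4 x e e' x'
  have h7 := dist_triangle4 e (γ t) (γ t') e'
  have h8 := dist_triangle_right o (γ t) e
  have h9 := dist_triangle_right o (γ t') e'
  have h10 := h.1
  have h11 := h'.1
  rw [gromovProduct, dist_comm x o]
  rw [dist_comm e (γ t)] at h7
  rw [dist_comm x e] at h6
  rcases abs_cases (t - t') with ⟨h12, -⟩ | ⟨h12, -⟩ <;> linarith

variable {G : Type*} [Group G] [Countable G] [MulAction G X] [IsIsometricSMul G X]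
  [MeasurableSpace G] [DiscreteMeasurableSpace G] {o : X} (μ : Measure G) [IsProbabilityMeasure μ]

theorem exists_waypoint_bound_of_isNonElementary (hX : IsGeodesicSpace X)
    (hμ : IsNonElementary o μ) :
    ∃ c C D : ℝ, 0 < c ∧ 0 < C ∧ 0 ≤ D ∧ ∀ k m : ℕ, k ≤ m →
      (stepMeasure μ).real {g | ¬ ∃ e : X, c * k - C ≤ dist o e ∧
        IsWaypoint D o (samplePath g k • o) (samplePath g m • o) e} ≤
      C * Real.exp (-(c * k)) := by
  obtain ⟨a, ha, b, hb, hac, hbc, hab⟩ := hμ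
  obtain ⟨L, M, 𝒢, D, h⟩ := exists_isPingPong hX hac hbc hab
  obtain ⟨u, hu, hu'⟩ := Submonoid.exists_list_of_mem_closure (pow_mem ha L)
  obtain ⟨v, hv, hv'⟩ := Submonoid.exists_list_of_mem_closure (pow_mem hb M)
  rw [← hu', ← hv'] at h
  obtain ⟨c, C, hc, hC, hbound⟩ := exists_waypoint_bound μ hX h hu hv
  exact ⟨c, C, D, hc, hC, h.nonneg, hbound⟩

lemma sum_Icc_exp_le {c : ℝ} (hc : 0 < c) (n m : ℕ) :
    ∑ k ∈ Icc n m, Real.exp (-(c * k)) ≤ Real.exp (-(c * n)) / (1 - Real.exp (-c)) := by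
  have hlt : Real.exp (-c) < 1 := by
    rw [← Real.exp_zero]; exact Real.exp_lt_exp.mpr (by linarith)
  have hpow : ∀ k : ℕ, Real.exp (-(c * k)) = Real.exp (-c) ^ k := fun k => by
    rw [← Real.exp_nat_mul]; congr 1; ring
  simp only [hpow]
  rw [← Ico_succ_right_eq_Icc]
  exact geom_sum_Ico_le_of_lt_one (Real.exp_pos _).le hlt

/-- All Gromov products of the walk after time `n` grow linearly, with overwhelming
probability. -/
theorem exists_gromovProduct_bound (hX : IsGeodesicSpace X) (hμ : IsNonElementary o μ) :
    ∃ c C : ℝ, 0 < c ∧ 0 < C ∧ ∀ n : ℕ,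
      (stepMeasure μ).real {g | ∃ k k' : ℕ, n ≤ k ∧ n ≤ k' ∧
        gromovProduct o (samplePath g k • o) (samplePath g k' • o) < c * n - C} ≤
      C * Real.exp (-(c * n)) := by
  obtain ⟨c, C, D, hc, hC, hD, hbound⟩ := exists_waypoint_bound_of_isNonElementary μ hX hμ
  have hlt : 0 < 1 - Real.exp (-c) := by
    rw [sub_pos, ← Real.exp_zero]; exact Real.exp_lt_exp.mpr (by linarith)
  -- `5 * D` is the loss in `IsWaypoint.le_gromovProduct`, and the last term comes from the
  -- geometric series over `k ≥ n`.
  refine ⟨c, C + 5 * D + C / (1 - Real.exp (-c)), hc, by positivity, fun n => ?_⟩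
  set C' := C + 5 * D + C / (1 - Real.exp (-c)) with hC'
  have hq : 0 < C / (1 - Real.exp (-c)) := by positivity
  -- A finite horizon `m` provides the common endpoint, so the union bound runs over single times
  -- rather than pairs. The bound is uniform in `m` and passes to the increasing union.
  set S : ℕ → Set (ℤ → G) := fun m => {g | ∃ k k' : ℕ, n ≤ k ∧ n ≤ k' ∧ k ≤ m ∧ k' ≤ m ∧
    gromovProduct o (samplePath g k • o) (samplePath g k' • o) < c * n - C'} with hS
  have hfin : ∀ m, (stepMeasure μ).real (S m) ≤ C' * Real.exp (-(c * n)) := by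
    intro m
    refine (measureReal_mono (s₂ := ⋃ k ∈ Icc n m, {g | ¬ ∃ e : X, c * k - C ≤ dist o e ∧
        IsWaypoint D o (samplePath g k • o) (samplePath g m • o) e}) ?_
        (measure_ne_top _ _)).trans ((measureReal_biUnion_finset_le (Icc n m) fun k : ℕ =>
          {g | ¬ ∃ e : X, c * k - C ≤ dist o e ∧
        IsWaypoint D o (samplePath g k • o) (samplePath g m • o) e}).trans ?_)
    · rintro g ⟨k, k', hk, hk', hkm, hkm', hlt'⟩
      by_contra hcon
      simp only [Set.mem_iUnion, Set.mem_ofPred_eq, not_exists, mem_Icc] at hcon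
      have hmono : ∀ i : ℕ, n ≤ i → c * n - C ≤ c * i - C := fun i hi => by gcongr
      obtain ⟨e, he, hw⟩ := not_forall_not.mp (hcon k ⟨hk, hkm⟩)
      obtain ⟨e', he', hw'⟩ := not_forall_not.mp (hcon k' ⟨hk', hkm'⟩)
      have := hw.le_gromovProduct hX hw' ((hmono k hk).trans he) ((hmono k' hk').trans he')
      linarith
    · calc _ ≤ ∑ k ∈ Icc n m, C * Real.exp (-(c * k)) :=
            sum_le_sum fun k hk => hbound k m (mem_Icc.mp hk).2
        _ ≤ C * (Real.exp (-(c * n)) / (1 - Real.exp (-c))) := by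
            rw [← mul_sum]
            exact mul_le_mul_of_nonneg_left (sum_Icc_exp_le hc n m) hC.le
        _ = C / (1 - Real.exp (-c)) * Real.exp (-(c * n)) := by ring
        _ ≤ C' * Real.exp (-(c * n)) := by gcongr; linarith
  have hunion : {g : ℤ → G | ∃ k k' : ℕ, n ≤ k ∧ n ≤ k' ∧
      gromovProduct o (samplePath g k • o) (samplePath g k' • o) < c * n - C'} = ⋃ m, S m := by
    ext g
    simp only [hS, Set.mem_iUnion, Set.mem_ofPred_eq]
    constructor
    · rintro ⟨k, k', h1, h2, h3⟩
      exact ⟨max k k', k, k', h1, h2, le_max_left _ _, le_max_right _ _, h3⟩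
    · rintro ⟨m, k, k', h1, h2, -, -, h3⟩
      exact ⟨k, k', h1, h2, h3⟩
  have hSmono : Monotone S := by
    rintro m m' hmm g ⟨k, k', h1, h2, h3, h4, h5⟩
    exact ⟨k, k', h1, h2, h3.trans hmm, h4.trans hmm, h5⟩
  rw [hunion, measureReal_def]
  refine ENNReal.toReal_le_of_le_ofReal (by positivity) ?_
  refine le_of_tendsto' (tendsto_measure_iUnion_atTop hSmono) fun m => ?_
  exact (ENNReal.le_ofReal_iff_toReal_le (measure_ne_top _ _) (by positivity)).mpr (hfin m)

end Conclusion

end ContractingWalk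

theorem corollary4 {X : Type*} [MetricSpace X] (hX : ContractingWalk.IsGeodesicSpace X)
    {G : Type*} [Group G] [Countable G] [MulAction G X] [IsIsometricSMul G X]
    [MeasurableSpace G] [DiscreteMeasurableSpace G]
    (o : X) (μ : MeasureTheory.Measure G) [MeasureTheory.IsProbabilityMeasure μ]
    (hμ : ContractingWalk.IsNonElementary o μ) :
    ∃ K : ℝ, 0 < K ∧ ∀ n : ℕ,
      (ContractingWalk.stepMeasure μ).real
          {g | dist o (ContractingWalk.samplePath g n • o) ≤ K * n}
        ≤ 1 / K * Real.exp (-K * n) ∧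
      (ContractingWalk.stepMeasure μ).real
          {g | (⨅ p : Set.Ici n × Set.Ici n,
              ContractingWalk.gromovProduct o
                (ContractingWalk.samplePath g p.1 • o)
                (ContractingWalk.samplePath g p.2 • o)) ≤ K * n}
        ≤ 1 / K * Real.exp (-K * n) := by
  obtain ⟨c, C, hc, hC, hbound⟩ := ContractingWalk.exists_gromovProduct_bound μ hX hμ
  -- For `n ≤ T` the claimed bound is at least `1`, because `K ≤ exp (-T)` and `K ≤ 1`. For `n > T`,
  -- `c * n - C` exceeds `c / 2 * n`, hence `K * n`.
  set T := 2 * C / c with hT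
  set K := min (min 1 (c / 2)) (min (1 / C) (Real.exp (-T))) with hK
  have hK0 : 0 < K := by positivity
  have hK1 : K ≤ 1 := (min_le_left _ _).trans (min_le_left _ _)
  have hKc : K ≤ c / 2 := (min_le_left _ _).trans (min_le_right _ _)
  have hKC : C ≤ 1 / K := by
    rw [le_div_iff₀ hK0, mul_comm, ← le_div_iff₀ hC]
    exact (min_le_right _ _).trans (min_le_left _ _)
  have hKT : Real.exp T ≤ 1 / K := by
    rw [le_div_iff₀ hK0]
    calc Real.exp T * K ≤ Real.exp T * Real.exp (-T) := by
          gcongr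
          exact (min_le_right _ _).trans (min_le_right _ _)
      _ = 1 := by rw [← Real.exp_add, add_neg_cancel, Real.exp_zero]
  have hsecond : ∀ n : ℕ, (ContractingWalk.stepMeasure μ).real
          {g | (⨅ p : Set.Ici n × Set.Ici n,
              ContractingWalk.gromovProduct o
                (ContractingWalk.samplePath g p.1 • o)
                (ContractingWalk.samplePath g p.2 • o)) ≤ K * n}
        ≤ 1 / K * Real.exp (-K * n) := by
    intro n
    have hn0 : (0 : ℝ) ≤ n := n.cast_nonneg
    rcases le_or_gt (n : ℝ) T with hn | hn
    · refine MeasureTheory.measureReal_le_one.trans ?_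
      calc (1 : ℝ) = Real.exp T * Real.exp (-T) := by
            rw [← Real.exp_add, add_neg_cancel, Real.exp_zero]
        _ ≤ 1 / K * Real.exp (-K * n) := by
            gcongr
            nlinarith
    · have hgap : K * n < c * n - C := by
        rw [hT, div_lt_iff₀ hc] at hn
        nlinarith
      refine (MeasureTheory.measureReal_mono (fun g hg => ?_)
        (MeasureTheory.measure_ne_top _ _)).trans ((hbound n).trans ?_)
      · have : Nonempty (Set.Ici n × Set.Ici n) := ⟨(⟨n, Set.self_mem_Ici⟩, ⟨n, Set.self_mem_Ici⟩)⟩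
        obtain ⟨p, hp⟩ := exists_lt_of_ciInf_lt (lt_of_le_of_lt hg hgap)
        exact ⟨p.1, p.2, p.1.2, p.2.2, hp⟩
      · gcongr
        nlinarith
  refine ⟨K, hK0, fun n => ⟨(MeasureTheory.measureReal_mono (fun g hg => ?_)
    (MeasureTheory.measure_ne_top _ _)).trans (hsecond n), hsecond n⟩⟩
  -- The pair `k = k' = n` bounds the infimum by `dist o (samplePath g n • o)`, so the first event
  -- lies in the second.
  rw [Set.mem_ofPred_eq] at hg ⊢
  refine le_trans (ciInf_le ⟨0, ?_⟩ ((⟨n, Set.self_mem_Ici⟩, ⟨n, Set.self_mem_Ici⟩) : Set.Ici n × Set.Ici n)) ?_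
  · rintro _ ⟨p, rfl⟩
    exact ContractingWalk.gromovProduct_nonneg _ _ _
  · rwa [ContractingWalk.gromovProduct_self]
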